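/- Let $\alpha>0$ and $\varphi>0$, and consider the weight $$w(t)=\frac1{2\pi}\,|\Gamma(\alpha/2+it)|^2e^{\pi t},\qquad t\in\mathbb R,$$ and the Hilbert space $L^2(\mathbb R,w(t)\,dt)$. Put $$\Psi(s)=|s|^{\alpha-1}\exp\bigl(\pi\,\mathrm{Re}\,s-\pi|\mathrm{Re}\,s|\bigr),\qquad s\in\mathbb C.$$ Let $\mathcal H[w]$ be the space of all functions $f$ that are holomorphic in the closed strip $|\mathrm{Im}\,s|\le1$ (that is, in some larger strip $|\mathrm{Im}\,s|<1+\delta$, $\delta>0$) and $w$-decreasing there, i.e. for some $\varepsilon>0$ $$f(s)=O\bigl(\Psi(s)^{-1/2}|s|^{-3/2-\varepsilon}\bigr),\qquad s\to\infty,\ |\mathrm{Im}\,s|\le 1 .$$ Consider the difference operator $$\mathcal L f(t)=i(\alpha/2+it)\,f(t-i)+2\cosh\varphi\; t\,f(t)-i(\alpha/2-it)\,f(t+i).$$ Theorem. For every $f\in\mathcal H[w]$ the restrictions of $f$ and $\mathcal Lf$ to $\mathbb R$ belong to $L^2(\mathbb R,w(t)\,dt)$, and the operator $\mathcal L$ with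 domain $\mathcal H[w]$ is essentially self-adjoint in $L^2(\mathbb R,w(t)\,dt)$: it is densely defined, symmetric and closable, and its closure is self-adjoint. -/

import Mathlib

open MeasureTheory Filter Topology Asymptotics

noncomputable section

/-- A partially defined operator on a Hilbert space is essentially self-adjoint if it is densely
defined, symmetric, (hence) closable, and its closure is self-adjoint. -/
def LinearPMap.IsEssentiallySelfAdjoint {E : Type*} [NormedAddCommGroup E]
    [InnerProductSpace ℂ E] [CompleteSpace E] (T : E →ₗ.[ℂ] E) : Prop :=
  Dense (T.domain : Set E) ∧ T.IsFormalAdjoint T ∧ T.IsClosable ∧ IsSelfAdjoint T.closure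

namespace Vilenkin

/-- The weight `w(t) = (2π)⁻¹ |Γ(α/2 + it)|² e^{πt}` on the real line. -/
def weight (α : ℝ) (t : ℝ) : ℝ :=
  1 / (2 * Real.pi) * ‖Complex.Gamma (α / 2 + Complex.I * t)‖ ^ 2 * Real.exp (Real.pi * t)

/-- The measure `w(t) dt` on the real line. -/
def weightMeasure (α : ℝ) : Measure ℝ :=
  volume.withDensity fun t => ENNReal.ofReal (weight α t)

/-- The Hilbert space `L²(ℝ, w(t) dt)`. -/
abbrev L2w (α : ℝ) : Type := Lp ℂ 2 (weightMeasure α)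

/-- The comparison function `Ψ(s) = |s|^{α - 1} exp (π Re s - π |Re s|)`: by Stirling's formula it
is, up to a constant factor, the modulus of the analytic continuation of the weight at infinity
in horizontal strips. -/
def Psi (α : ℝ) (s : ℂ) : ℝ :=
  ‖s‖ ^ (α - 1) * Real.exp (Real.pi * s.re - Real.pi * |s.re|)

/-- `f` is `w`-decreasing in the strip `|Im s| ≤ 1`: for some `ε > 0`,
`f(s) = O(Ψ(s)^{-1/2} |s|^{-3/2-ε})` as `s → ∞` in this strip. -/
def IsWDecreasing (α : ℝ) (f : ℂ → ℂ) : Prop :=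
  ∃ ε : ℝ, 0 < ε ∧
    f =O[Bornology.cobounded ℂ ⊓ 𝓟 {s : ℂ | |s.im| ≤ 1}]
      fun s : ℂ => Psi α s ^ (-(1 / 2) : ℝ) * ‖s‖ ^ (-(3 / 2) - ε)

/-- `f` is holomorphic in the closed strip `|Im s| ≤ 1`, that is, in a larger open strip. -/
def IsHolomorphicInStrip (f : ℂ → ℂ) : Prop :=
  ∃ δ : ℝ, 0 < δ ∧ DifferentiableOn ℂ f {s : ℂ | |s.im| < 1 + δ}

theorem IsWDecreasing.zero (α : ℝ) : IsWDecreasing α 0 :=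
  ⟨1, one_pos, isBigO_zero _ _⟩

theorem IsWDecreasing.add {α : ℝ} {f g : ℂ → ℂ} (hf : IsWDecreasing α f)
    (hg : IsWDecreasing α g) : IsWDecreasing α (f + g) := by
  have key : ∀ ε ε' : ℝ, ε' ≤ ε →
      (fun s : ℂ => Psi α s ^ (-(1 / 2) : ℝ) * ‖s‖ ^ (-(3 / 2) - ε))
        =O[Bornology.cobounded ℂ ⊓ 𝓟 {s : ℂ | |s.im| ≤ 1}]
      fun s : ℂ => Psi α s ^ (-(1 / 2) : ℝ) * ‖s‖ ^ (-(3 / 2) - ε') := by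
    intro ε ε' h
    refine (isBigO_refl _ _).mul (IsBigO.of_bound 1 ?_)
    have h1 : ∀ᶠ s : ℂ in Bornology.cobounded ℂ, (1 : ℝ) ≤ ‖s‖ :=
      tendsto_norm_cobounded_atTop.eventually (eventually_ge_atTop 1)
    filter_upwards [h1.filter_mono inf_le_left] with s hs
    rw [one_mul, Real.norm_of_nonneg (by positivity), Real.norm_of_nonneg (by positivity)]
    exact Real.rpow_le_rpow_of_exponent_le hs (by linarith)
  obtain ⟨ε₁, h₁, hf⟩ := hf
  obtain ⟨ε₂, h₂, hg⟩ := hg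
  exact ⟨min ε₁ ε₂, lt_min h₁ h₂,
    (hf.trans (key _ _ (min_le_left _ _))).add (hg.trans (key _ _ (min_le_right _ _)))⟩

theorem IsHolomorphicInStrip.add {f g : ℂ → ℂ} (hf : IsHolomorphicInStrip f)
    (hg : IsHolomorphicInStrip g) : IsHolomorphicInStrip (f + g) := by
  obtain ⟨δ₁, h₁, hf⟩ := hf
  obtain ⟨δ₂, h₂, hg⟩ := hg
  refine ⟨min δ₁ δ₂, lt_min h₁ h₂, (hf.mono ?_).add (hg.mono ?_)⟩
  · intro s hs
    exact lt_of_lt_of_le (Set.mem_ofPred_eq ▸ hs) (add_le_add_right (min_le_left _ _) 1)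
  · intro s hs
    exact lt_of_lt_of_le (Set.mem_ofPred_eq ▸ hs) (add_le_add_right (min_le_right _ _) 1)

/-- The space `𝓗[w]` of functions that are holomorphic in the closed strip `|Im s| ≤ 1` and
`w`-decreasing in it. -/
def H (α : ℝ) : Submodule ℂ (ℂ → ℂ) where
  carrier := {f | IsHolomorphicInStrip f ∧ IsWDecreasing α f}
  zero_mem' := ⟨⟨1, one_pos, differentiableOn_const 0⟩, IsWDecreasing.zero α⟩
  add_mem' := fun hf hg => ⟨hf.1.add hg.1, hf.2.add hg.2⟩
  smul_mem' := by
    rintro c f ⟨⟨δ, hδ, hf⟩, ε, hε, hO⟩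
    exact ⟨⟨δ, hδ, hf.const_smul c⟩, ε, hε, hO.const_smul_left c⟩

/-- The difference expression
`𝓛 f(s) = i(α/2 + is) f(s - i) + 2 cosh φ · s f(s) - i(α/2 - is) f(s + i)`. -/
def differenceExpr (α φ : ℝ) (f : ℂ → ℂ) (s : ℂ) : ℂ :=
  Complex.I * (α / 2 + Complex.I * s) * f (s - Complex.I)
    + 2 * Real.cosh φ * s * f s
    - Complex.I * (α / 2 - Complex.I * s) * f (s + Complex.I)

/-- The graph of the difference operator in `L²(ℝ, w(t) dt)`: the pairs `(u, v)` such that, for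
some `f ∈ 𝓗[w]`, `u` is the class of `f|ℝ` and `v` is the class of `(𝓛 f)|ℝ`. -/
def operatorGraph (α φ : ℝ) : Submodule ℂ (L2w α × L2w α) where
  carrier := {p | ∃ f ∈ H α, (p.1 =ᵐ[weightMeasure α] fun t : ℝ => f t) ∧
    (p.2 =ᵐ[weightMeasure α] fun t : ℝ => differenceExpr α φ f t)}
  zero_mem' := by
    refine ⟨0, (H α).zero_mem, ?_, ?_⟩
    · filter_upwards [Lp.coeFn_zero ℂ 2 (weightMeasure α)] with t ht
      simpa using ht
    · filter_upwards [Lp.coeFn_zero ℂ 2 (weightMeasure α)] with t ht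
      simpa [differenceExpr] using ht
  add_mem' := by
    rintro p q ⟨f, hf, hf1, hf2⟩ ⟨g, hg, hg1, hg2⟩
    refine ⟨f + g, (H α).add_mem hf hg, ?_, ?_⟩
    · filter_upwards [Lp.coeFn_add p.1 q.1, hf1, hg1] with t h h1 h2
      simp only [Prod.fst_add, h, Pi.add_apply, h1, h2]
    · filter_upwards [Lp.coeFn_add p.2 q.2, hf2, hg2] with t h h1 h2
      simp only [Prod.snd_add, h, Pi.add_apply, h1, h2, differenceExpr]
      ring
  smul_mem' := by
    rintro c p ⟨f, hf, hf1, hf2⟩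
    refine ⟨c • f, (H α).smul_mem c hf, ?_, ?_⟩
    · filter_upwards [Lp.coeFn_smul c p.1, hf1] with t h h1
      simp only [Prod.smul_fst, h, Pi.smul_apply, h1]
    · filter_upwards [Lp.coeFn_smul c p.2, hf2] with t h h1
      simp only [Prod.smul_snd, h, Pi.smul_apply, h1, differenceExpr, smul_eq_mul]
      ring

/-- The difference operator `𝓛` in `L²(ℝ, w(t) dt)` with domain `𝓗[w]`. That `operatorGraph` is
the graph of a function is shown in `operatorGraph_functional`. -/
def operator (α φ : ℝ) : L2w α →ₗ.[ℂ] L2w α :=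
  (operatorGraph α φ).toLinearPMap

theorem weight_pos {α : ℝ} (hα : 0 < α) (t : ℝ) : 0 < weight α t := by
  have h : Complex.Gamma (α / 2 + Complex.I * t) ≠ 0 := by
    apply Complex.Gamma_ne_zero_of_re_pos
    simpa using hα
  unfold weight
  have := norm_pos_iff.mpr h
  positivity

theorem measurable_weight {α : ℝ} (hα : 0 < α) : Measurable (weight α) := by
  have h : Continuous fun t : ℝ => Complex.Gamma (α / 2 + Complex.I * t) := by
    refine continuous_iff_continuousAt.mpr fun t => ?_
    have h1 : ContinuousAt Complex.Gamma (α / 2 + Complex.I * t) := by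
      refine (Complex.differentiableAt_Gamma _ fun m hm => ?_).continuousAt
      have h2 := congrArg Complex.re hm
      simp at h2
      have : (0 : ℝ) ≤ m := m.cast_nonneg
      linarith
    exact ContinuousAt.comp (f := fun t : ℝ => (α / 2 + Complex.I * t : ℂ)) h1
      (by fun_prop)
  have h' : Continuous (weight α) := by
    unfold weight
    fun_prop
  exact h'.measurable

theorem volume_absolutelyContinuous {α : ℝ} (hα : 0 < α) : volume ≪ weightMeasure α := by
  refine withDensity_absolutelyContinuous' (measurable_weight hα).ennreal_ofReal.aemeasurable ?_
  refine Eventually.of_forall fun t => ?_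
  simpa using weight_pos hα t

/-- A function in `𝓗[w]` that vanishes almost everywhere on the real line vanishes in the strip. -/
theorem eq_zero_of_ae {α : ℝ} (hα : 0 < α) {f : ℂ → ℂ} (hf : f ∈ H α)
    (h : (fun t : ℝ => f t) =ᵐ[weightMeasure α] 0) {s : ℂ} (hs : |s.im| ≤ 1) : f s = 0 := by
  obtain ⟨⟨δ, hδ, hd⟩, -⟩ := hf
  set U : Set ℂ := {s : ℂ | |s.im| < 1 + δ} with hU
  have hopen : IsOpen U := isOpen_lt (by fun_prop) continuous_const
  have hreal : ∀ t : ℝ, (t : ℂ) ∈ U := fun t => by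
    simp only [hU, Set.mem_ofPred_eq, Complex.ofReal_im, abs_zero]
    linarith
  have hcont : Continuous fun t : ℝ => f t :=
    hd.continuousOn.comp_continuous Complex.continuous_ofReal hreal
  have hzero : (fun t : ℝ => f t) = 0 :=
    (hcont.ae_eq_iff_eq (volume : Measure ℝ) continuous_const).mp
      ((volume_absolutelyContinuous hα).ae_eq h)
  have hconv : Convex ℝ U := by
    have : U = Complex.imLm ⁻¹' Metric.ball 0 (1 + δ) := by
      ext s
      simp [hU]
    rw [this]
    exact (convex_ball _ _).linear_preimage _
  have hfreq : ∃ᶠ z in 𝓝[≠] (0 : ℂ), f z = 0 := by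
    have ht : Tendsto (fun t : ℝ => (t : ℂ)) (𝓝[≠] (0 : ℝ)) (𝓝[≠] (0 : ℂ)) := by
      refine tendsto_nhdsWithin_iff.mpr ⟨?_, ?_⟩
      · exact (Complex.continuous_ofReal.tendsto' 0 0 (by simp)).mono_left nhdsWithin_le_nhds
      · filter_upwards [self_mem_nhdsWithin] with t ht
        simpa using ht
    exact ht.frequently (Frequently.of_forall fun t => congrFun hzero t)
  have hana : AnalyticOnNhd ℂ f U := hd.analyticOnNhd hopen
  exact hana.eqOn_zero_of_preconnected_of_frequently_eq_zero hconv.isPreconnected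
    (by simpa using hreal 0) hfreq (lt_of_le_of_lt hs (by linarith))

theorem operatorGraph_functional {α : ℝ} (hα : 0 < α) (φ : ℝ) (p : L2w α × L2w α)
    (hp : p ∈ operatorGraph α φ) (h : p.1 = 0) : p.2 = 0 := by
  obtain ⟨f, hf, hf1, hf2⟩ := hp
  have h0 : (fun t : ℝ => f t) =ᵐ[weightMeasure α] 0 := by
    refine hf1.symm.trans ?_
    rw [h]
    exact Lp.coeFn_zero ℂ 2 (weightMeasure α)
  refine Lp.eq_zero_iff_ae_eq_zero.mpr (hf2.trans (Eventually.of_forall fun t => ?_))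
  simp only [differenceExpr, Pi.zero_apply]
  rw [eq_zero_of_ae hα hf h0 (s := (t : ℂ)) (by simp),
    eq_zero_of_ae hα hf h0 (s := (t : ℂ) - Complex.I) (by simp),
    eq_zero_of_ae hα hf h0 (s := (t : ℂ) + Complex.I) (by simp)]
  simp

/-- The graph of `operator α φ` is the intended one. -/
theorem mem_graph_operator {α : ℝ} (hα : 0 < α) (φ : ℝ) (u v : L2w α) :
    (u, v) ∈ (operator α φ).graph ↔
      ∃ f ∈ H α, (u =ᵐ[weightMeasure α] fun t : ℝ => f t) ∧
        (v =ᵐ[weightMeasure α] fun t : ℝ => differenceExpr α φ f t) := by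
  rw [operator, Submodule.toLinearPMap_graph_eq _ (operatorGraph_functional hα φ)]
  rfl

end Vilenkin

end

noncomputable section

/-! The multiplication operator and the two imaginary shifts generate a copy of sl(2), and a
suitable basis turns `operator` into a Jacobi matrix to which Carleman's criterion applies.

Symmetry is a contour shift. The weight continues analytically, and moving the integral from ℝ to ℝ
+ i shows that `shiftDown` is skew-symmetric on `H α` (`integral_shiftDown`); conjugation gives the
same for `shiftUp`. Stirling-type bounds for Γ in vertical strips (`Complex.norm_Gamma_le`) make the
shift and all L² claims legitimate.

Split the expression as `diffOp α 0` plus multiplication by 2 cosh φ · t. The function exp(-πs/2) is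
an eigenfunction of `diffOp α 0`, and `raise` produces from it eigenfunctions with eigenvalues -(α +
2n). They are orthogonal, and 4t = `raise` + `lower`, so in this basis the full operator is
tridiagonal; after normalisation its off-diagonal entries are cosh φ · √((n+1)(α+n)). They grow
linearly, their reciprocals have divergent sum, and a square-summable solution of the recurrence at
a non-real spectral parameter must vanish (`eq_zero_of_jacobi_recurrence`).

The basis is complete because a function with exponential decay is determined by its moments
(`eq_zero_of_inner_eigenvec`). Hence a vector in a deficiency space has zero coefficients and is
zero (`operator_deficiency`), and von Neumann's criterion concludes. -/

/-! ### The abstract criterion for essential self-adjointness. -/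

/-- A densely defined symmetric operator whose deficiency spaces at `±i` vanish is essentially
self-adjoint. -/
theorem LinearPMap.isEssentiallySelfAdjoint_of_deficiency {E : Type*} [NormedAddCommGroup E]
    [InnerProductSpace ℂ E] [CompleteSpace E] {T : E →ₗ.[ℂ] E} (hd : Dense (T.domain : Set E))
    (hs : T.IsFormalAdjoint T)
    (h₁ : ∀ u : E, (∀ x : T.domain, inner ℂ (T x - Complex.I • (x : E)) u = 0) → u = 0)
    (h₂ : ∀ u : E, (∀ x : T.domain, inner ℂ (T x + Complex.I • (x : E)) u = 0) → u = 0) :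
    T.IsEssentiallySelfAdjoint := by
  have hc : T.IsClosable :=
    (LinearPMap.adjoint_isClosed hd).isClosable.leIsClosable (hs.le_adjoint hd)
  refine ⟨hd, hs, hc, ?_⟩
  have hg : T.closure.graph = T.graph.topologicalClosure :=
    hc.graph_closure_eq_closure_graph.symm
  have hd' : Dense (T.closure.domain : Set E) := hd.mono T.le_closure.1
  have hsym : ∀ p ∈ T.closure.graph, ∀ q ∈ T.closure.graph,
      inner ℂ p.2 q.1 = inner ℂ p.1 q.2 := by
    have h0 : ∀ p ∈ T.graph, ∀ q ∈ T.graph, inner ℂ p.2 q.1 = inner ℂ p.1 q.2 := by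
      rintro ⟨x, x'⟩ hx ⟨y, y'⟩ hy
      rw [LinearPMap.mem_graph_iff] at hx hy
      obtain ⟨a, rfl, rfl⟩ := hx
      obtain ⟨b, rfl, rfl⟩ := hy
      exact hs a b
    have h3 : ∀ p ∈ T.graph, ∀ q ∈ _root_.closure (T.graph : Set (E × E)),
        inner ℂ p.2 q.1 = inner ℂ p.1 q.2 := by
      intro p hp q hq
      have hcl : _root_.IsClosed {q : E × E | (inner ℂ p.2 q.1 : ℂ) = inner ℂ p.1 q.2} :=
        isClosed_eq (by fun_prop) (by fun_prop)
      exact closure_minimal (fun q hq => h0 p hp q hq) hcl hq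
    intro p hp q hq
    rw [hg] at hp hq
    have hcl : _root_.IsClosed {p : E × E | (inner ℂ p.2 q.1 : ℂ) = inner ℂ p.1 q.2} :=
      isClosed_eq (by fun_prop) (by fun_prop)
    exact closure_minimal (fun p hp => h3 p hp q hq) hcl hp
  let Φ : T.closure.graph →L[ℂ] E :=
    (ContinuousLinearMap.snd ℂ E E - Complex.I • ContinuousLinearMap.fst ℂ E E).comp
      T.closure.graph.subtypeL
  have hΦ : ∀ p : T.closure.graph, Φ p = (p : E × E).2 - Complex.I • (p : E × E).1 :=
    fun p => rfl
  -- Symmetry kills the cross term: ‖y - ix‖² = ‖x‖² + ‖y‖² on the closed graph, which dominates the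
  -- square of the sup norm of the product. So `Φ` is bounded below and has closed range.
  have hbound : ∀ p : T.closure.graph, ‖p‖ ≤ ‖Φ p‖ := by
    intro p
    have h := hsym p p.2 p p.2
    have hre : (inner ℂ (p : E × E).2 (Complex.I • (p : E × E).1) : ℂ).re = 0 := by
      have him := congrArg Complex.im h
      rw [← inner_conj_symm (𝕜 := ℂ) (p : E × E).1, Complex.conj_im] at him
      rw [inner_smul_right]
      simp
      linarith
    have hn := norm_sub_sq (𝕜 := ℂ) (p : E × E).2 (Complex.I • (p : E × E).1)
    rw [← hΦ, norm_smul, Complex.norm_I, one_mul] at hn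
    simp only [RCLike.re_to_complex, hre] at hn
    have hp : ‖p‖ = max ‖(p : E × E).1‖ ‖(p : E × E).2‖ := rfl
    rw [hp, max_le_iff]
    constructor <;> refine abs_le_of_sq_le_sq' ?_ (norm_nonneg _) |>.2 <;>
      nlinarith [sq_nonneg ‖(p : E × E).1‖, sq_nonneg ‖(p : E × E).2‖]
  have hcl : _root_.IsClosed (T.closure.graph : Set (E × E)) := hc.closure_isClosed
  have : CompleteSpace T.closure.graph := hcl.completeSpace_coe
  have hr : _root_.IsClosed (LinearMap.range Φ.toLinearMap : Set E) :=
    (AddMonoidHomClass.antilipschitz_of_bound (K := 1) Φ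
      (by simpa using hbound)).isClosed_range Φ.uniformContinuous
  have hmem : ∀ x : T.domain, ((x : E), T x) ∈ T.closure.graph := fun x =>
    LinearPMap.le_graph_of_le T.le_closure (T.mem_graph x)
  have hsurj : LinearMap.range Φ.toLinearMap = ⊤ := by
    rw [← hr.submodule_topologicalClosure_eq, Submodule.topologicalClosure_eq_top_iff,
      Submodule.eq_bot_iff]
    intro u hu
    exact h₁ u fun x => (Submodule.mem_orthogonal _ u).mp hu _ ⟨⟨_, hmem x⟩, rfl⟩
  rw [LinearPMap.isSelfAdjoint_def]
  refine LinearPMap.eq_of_eq_graph ?_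
  rw [LinearPMap.adjoint_graph_eq_graph_adjoint hd']
  refine le_antisymm ?_ fun p hp => (Submodule.mem_adjoint_iff _ _).mpr fun a b hab =>
    sub_eq_zero.mpr (hsym (a, b) hab p hp)
  rintro ⟨v, w⟩ hv
  rw [Submodule.mem_adjoint_iff] at hv
  -- Given (v, w) in the adjoint graph, solve (closure of T - i)x = w - iv; then v - x lies in the
  -- other deficiency space, so `h₂` forces v = x.
  obtain ⟨⟨⟨x, y⟩, hxy⟩, h⟩ : w - Complex.I • v ∈ LinearMap.range Φ.toLinearMap := by simp [hsurj]
  replace h : y - Complex.I • x = w - Complex.I • v := h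
  have hwy : w - y = Complex.I • (v - x) := by
    rw [smul_sub, sub_eq_sub_iff_sub_eq_sub]
    rw [sub_eq_sub_iff_add_eq_add] at h ⊢
    rw [h, add_comm]
  have hvx : v - x = 0 := by
    refine h₂ _ fun a => ?_
    have e1 := hv _ _ (hmem a)
    have e2 := hsym _ (hmem a) _ hxy
    simp only at e1 e2
    have e3 : inner ℂ (T a) (v - x) = inner ℂ (a : E) (w - y) := by
      rw [inner_sub_right, inner_sub_right, e2, sub_eq_zero.mp e1]
    rw [inner_add_left, e3, hwy, inner_smul_left, inner_smul_right]
    simp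
  have hwy' : w = y := by rw [hvx, smul_zero] at hwy; exact sub_eq_zero.mp hwy
  rw [sub_eq_zero.mp hvx, hwy']
  exact hxy

/-! ### Estimates of the Gamma function in vertical strips. -/

/-- The Gamma function is bounded on vertical lines by its value on the real axis. -/
theorem Complex.norm_Gamma_le_Gamma_re {z : ℂ} (hz : 0 < z.re) : ‖Gamma z‖ ≤ Real.Gamma z.re := by
  rw [Complex.Gamma_eq_integral hz, Real.Gamma_eq_integral hz, Complex.GammaIntegral]
  refine (norm_integral_le_integral_norm _).trans_eq ?_
  refine setIntegral_congr_fun measurableSet_Ioi fun x hx => ?_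
  have hx' : 0 < x := hx
  simp [Complex.norm_cpow_eq_rpow_re_of_pos hx', Complex.norm_exp]

/-- The modulus of the Gamma function on the critical line `Re z = 1/2`. -/
theorem Complex.norm_Gamma_half_add_sq_le {z : ℂ} (hz : z.re = 1 / 2) :
    ‖Gamma z‖ ^ 2 ≤ 2 * Real.pi * Real.exp (-(Real.pi * |z.im|)) := by
  have h := Complex.Gamma_mul_Gamma_one_sub z
  -- On this line the reflection formula pairs Γ(z) with its own conjugate, so |Γ(z)|² = π / cosh(π
  -- Im z).
  have hc : 1 - z = (starRingEnd ℂ) z := by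
    apply Complex.ext <;> simp [hz]; norm_num
  have hzz : z = 1 / 2 + z.im * I := by
    apply Complex.ext <;> simp [hz]
  have hs : Complex.sin (Real.pi * z) = (Real.cosh (Real.pi * z.im) : ℝ) := by
    rw [hzz, mul_add, show (Real.pi : ℂ) * (1 / 2) = Real.pi / 2 by ring, add_comm,
      Complex.sin_add_pi_div_two, ← mul_assoc, Complex.cos_mul_I]
    simp
  rw [hc, Complex.Gamma_conj, Complex.mul_conj, hs, ← Complex.ofReal_div,
    Complex.ofReal_inj, Complex.normSq_eq_norm_sq] at h
  rw [h, div_le_iff₀ (Real.cosh_pos _), Real.cosh_eq]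
  have h1 : Real.exp (Real.pi * |z.im|) ≤
      Real.exp (Real.pi * z.im) + Real.exp (-(Real.pi * z.im)) := by
    rcases abs_cases z.im with ⟨h, -⟩ | ⟨h, -⟩ <;> rw [h]
    · linarith [Real.exp_pos (-(Real.pi * z.im))]
    · rw [mul_neg]; linarith [Real.exp_pos (Real.pi * z.im)]
  have h2 : Real.exp (-(Real.pi * |z.im|)) * Real.exp (Real.pi * |z.im|) = 1 := by
    rw [← Real.exp_add]; simp
  have h3 := mul_le_mul_of_nonneg_left h1 (Real.exp_pos (-(Real.pi * |z.im|))).le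
  nlinarith [Real.pi_pos]

theorem Complex.one_add_abs_im_le {a : ℝ} (ha : 0 < a) {z : ℂ} (hz : a ≤ z.re) :
    1 + |z.im| ≤ (1 + 1 / a) * ‖z‖ := by
  have h1 := (hz.trans (le_abs_self _)).trans (Complex.abs_re_le_norm z)
  have h2 := Complex.abs_im_le_norm z
  have h3 : 1 ≤ 1 / a * ‖z‖ := by
    rw [one_div, inv_mul_eq_div, one_le_div ha]; exact h1
  linarith

theorem Complex.norm_le_mul_one_add_abs_im {b : ℝ} (hb : 1 ≤ b) {z : ℂ} (h0 : 0 ≤ z.re)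
    (hz : z.re ≤ b) : ‖z‖ ≤ b * (1 + |z.im|) := by
  have h := Complex.norm_le_abs_re_add_abs_im z
  rw [abs_of_nonneg h0] at h
  nlinarith [abs_nonneg z.im]

theorem Complex.im_mul_arg_eq (z : ℂ) : z.im * z.arg = |z.im| * |z.arg| := by
  rw [← abs_mul, eq_comm, abs_eq_self]
  rcases le_total 0 z.im with h | h
  · exact mul_nonneg h (Complex.arg_nonneg_iff.mpr h)
  · rcases h.lt_or_eq with h | h
    · exact mul_nonneg_of_nonpos_of_nonpos h.le (Complex.arg_neg_iff.mpr h).le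
    · simp [h]

theorem Complex.im_mul_arg_le {z : ℂ} (hz : 0 ≤ z.re) :
    z.im * z.arg ≤ Real.pi * |z.im| / 2 := by
  rw [Complex.im_mul_arg_eq]
  nlinarith [Complex.abs_arg_le_pi_div_two_iff.mpr hz, abs_nonneg z.im]

/-- Jordan's inequality applied to cos |arg z| = Re z / ‖z‖ gives ‖z‖(π/2 - |arg z|) ≤ (π/2) Re z,
so replacing the argument by ±π/2 costs only a bounded amount in a strip. -/
theorem Complex.le_im_mul_arg {z : ℂ} (hz : 0 < z.re) :
    Real.pi * |z.im| / 2 - Real.pi * z.re / 2 ≤ z.im * z.arg := by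
  rw [Complex.im_mul_arg_eq]
  have hz0 : z ≠ 0 := by rintro rfl; simp at hz
  have hn : 0 < ‖z‖ := norm_pos_iff.mpr hz0
  have h1 := Complex.abs_arg_le_pi_div_two_iff.mpr hz.le
  have h2 : Real.cos |z.arg| = z.re / ‖z‖ := by rw [Real.cos_abs, Complex.cos_arg hz0]
  have h3 := Real.mul_le_sin (x := Real.pi / 2 - |z.arg|) (by linarith)
    (by linarith [abs_nonneg z.arg])
  rw [Real.sin_pi_div_two_sub, h2, le_div_iff₀ hn] at h3
  have hpi := Real.pi_pos
  have h4 : |z.im| * (Real.pi / 2 - |z.arg|) ≤ ‖z‖ * (Real.pi / 2 - |z.arg|) :=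
    mul_le_mul_of_nonneg_right (Complex.abs_im_le_norm z) (by linarith)
  have h5 : ‖z‖ * (Real.pi / 2 - |z.arg|) ≤ Real.pi * z.re / 2 := by
    have : 2 / Real.pi * (Real.pi / 2 - |z.arg|) * ‖z‖ * (Real.pi / 2) =
      ‖z‖ * (Real.pi / 2 - |z.arg|) := by field_simp
    nlinarith
  linarith

/-- Decay of the Gamma function on the line `Re z = n + 1/2`. -/
theorem Complex.norm_Gamma_nat_add_half_le (n : ℕ) : ∃ C : ℝ, 0 < C ∧ ∀ z : ℂ, z.re = n + 1 / 2 →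
    ‖Gamma z‖ ≤ C * (1 + |z.im|) ^ n * Real.exp (-(Real.pi * |z.im| / 2)) := by
  induction n with
  | zero =>
    refine ⟨√(2 * Real.pi), by positivity, fun z hz => ?_⟩
    have h := Complex.norm_Gamma_half_add_sq_le (z := z) (by simpa using hz)
    refine abs_le_of_sq_le_sq' (h.trans_eq ?_) (by positivity) |>.2
    rw [mul_pow, mul_pow, Real.sq_sqrt (by positivity), ← Real.exp_nat_mul]
    simp; ring_nf
  | succ n ih =>
    obtain ⟨C, hC, h⟩ := ih
    refine ⟨(n + 1) * C, by positivity, fun z hz => ?_⟩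
    have hz0 : z - 1 ≠ 0 := by
      intro h0
      have := congrArg Complex.re h0
      simp [hz] at this
      have : (0 : ℝ) ≤ n := n.cast_nonneg
      linarith
    have hg := Complex.Gamma_add_one (z - 1) hz0
    rw [sub_add_cancel] at hg
    have h1 := h (z - 1) (by simp [hz]; ring)
    have h2 := Complex.norm_le_mul_one_add_abs_im (b := n + 1) (z := z - 1)
      (by simp) (by simp [hz]; linarith [n.cast_nonneg (α := ℝ)]) (by simp [hz]; norm_num)
    simp only [Complex.sub_im, Complex.one_im, sub_zero] at h1 h2
    rw [hg, norm_mul]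
    calc _ ≤ _ := mul_le_mul h2 h1 (norm_nonneg _) (by positivity)
      _ = _ := by ring

theorem Complex.norm_cpow_half_sub_self {z : ℂ} (hz : z ≠ 0) :
    ‖z ^ (1 / 2 - z)‖ = ‖z‖ ^ (1 / 2 - z.re) * Real.exp (z.im * z.arg) := by
  rw [Complex.norm_cpow_of_ne_zero hz, div_eq_mul_inv, ← Real.exp_neg]
  congr 2
  · simp
  · simp; ring

/-- Dividing Γ by its Stirling factor and applying Phragmén–Lindelöf: on the edges Re z = 1/2 and Re
z = n + 1/2 the bound follows from the half-integer case, and inside only crude growth is needed. -/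
theorem Complex.norm_Gamma_mul_cpow_le (n : ℕ) (hn : 0 < n) : ∃ C : ℝ, 0 < C ∧ ∀ z : ℂ,
    1 / 2 ≤ z.re → z.re ≤ n + 1 / 2 → ‖Gamma z * z ^ (1 / 2 - z)‖ ≤ C := by
  have hn' : (0 : ℝ) < n := by exact_mod_cast hn
  have edge : ∀ m : ℕ, ∃ C : ℝ, 0 < C ∧ ∀ z : ℂ, z.re = m + 1 / 2 →
      ‖Gamma z * z ^ (1 / 2 - z)‖ ≤ C := by
    intro m
    obtain ⟨C, hC, h⟩ := Complex.norm_Gamma_nat_add_half_le m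
    refine ⟨C * 3 ^ m, by positivity, fun z hz => ?_⟩
    have hm : (0 : ℝ) ≤ m := m.cast_nonneg
    have hz0 : z ≠ 0 := by rintro rfl; simp at hz; linarith
    have hzn : 0 < ‖z‖ := norm_pos_iff.mpr hz0
    have h1 := Complex.one_add_abs_im_le (a := 1 / 2) (by norm_num) (z := z) (by linarith)
    norm_num at h1
    have h2 := Complex.im_mul_arg_le (z := z) (by linarith)
    rw [norm_mul, Complex.norm_cpow_half_sub_self hz0, hz,
      show (1 / 2 : ℝ) - (m + 1 / 2) = -(m : ℝ) by ring, Real.rpow_neg hzn.le, Real.rpow_natCast]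
    calc _ ≤ (C * (1 + |z.im|) ^ m * Real.exp (-(Real.pi * |z.im| / 2))) *
          ((‖z‖ ^ m)⁻¹ * Real.exp (Real.pi * |z.im| / 2)) := by
          gcongr
          exact h z hz
      _ = C * (1 + |z.im|) ^ m * (‖z‖ ^ m)⁻¹ := by
          rw [Real.exp_neg]; field_simp
      _ ≤ C * (3 * ‖z‖) ^ m * (‖z‖ ^ m)⁻¹ := by gcongr
      _ = C * 3 ^ m := by rw [mul_pow]; field_simp
  obtain ⟨C₀, hC₀, h₀⟩ := edge 0
  obtain ⟨C₁, hC₁, h₁⟩ := edge n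
  have hcont : ContinuousOn Real.Gamma (Set.Icc (1 / 2 : ℝ) (n + 1 / 2)) := fun x hx =>
    (Real.differentiableAt_Gamma fun m => by
      have h1 := hx.1
      have : (0 : ℝ) ≤ m := m.cast_nonneg
      linarith).continuousAt.continuousWithinAt
  obtain ⟨M, hM⟩ := isCompact_Icc.exists_bound_of_continuousOn hcont
  refine ⟨max C₀ C₁, by positivity, fun z hz1 hz2 => ?_⟩
  refine PhragmenLindelof.vertical_strip (f := fun z => Gamma z * z ^ (1 / 2 - z)) (a := 1 / 2)
    (b := n + 1 / 2) ?_ ?_ (fun z hz => (h₀ z (by simpa using hz)).trans (le_max_left _ _))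
    (fun z hz => (h₁ z hz).trans (le_max_right _ _)) hz1 hz2
  · refine DifferentiableOn.diffContOnCl fun w hw => ?_
    have hw' : 1 / 2 ≤ w.re := by
      have : closure (Complex.re ⁻¹' Set.Ioo (1 / 2) (n + 1 / 2)) ⊆ {w | 1 / 2 ≤ w.re} :=
        closure_minimal (fun w hw => hw.1.le) (isClosed_le continuous_const Complex.continuous_re)
      exact this hw
    refine (DifferentiableAt.mul ?_ ?_).differentiableWithinAt
    · refine Complex.differentiableAt_Gamma _ fun m hm => ?_
      have h2 := congrArg Complex.re hm
      simp at h2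
      have : (0 : ℝ) ≤ m := m.cast_nonneg
      linarith
    · exact DifferentiableAt.cpow differentiableAt_id
        (by fun_prop) (Or.inl (by linarith))
  -- A strip of width n admits growth exp(B exp(c|Im z|)) with c < π/n. Half that rate suffices,
  -- since exp(π|Im z|/2) ≤ exp(n exp(π|Im z|/(2n))).
  · refine ⟨Real.pi / (2 * n), ?_, n, ?_⟩
    · rw [show (n : ℝ) + 1 / 2 - 1 / 2 = n by ring]
      refine div_lt_div_of_pos_left Real.pi_pos hn' (by linarith)
    · refine IsBigO.of_bound (M * 2 ^ n) ?_
      filter_upwards [mem_inf_of_right (mem_principal_self _)] with w hw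
      have hw1 : 1 / 2 < w.re := hw.1
      have hw2 : w.re < n + 1 / 2 := hw.2
      have hw0 : w ≠ 0 := by rintro rfl; simp at hw1; linarith
      have e1 := (Complex.norm_Gamma_le_Gamma_re (z := w) (by linarith)).trans
        ((le_abs_self _).trans (hM _ ⟨hw1.le, hw2.le⟩))
      have e2 : ‖w‖ ^ (1 / 2 - w.re) ≤ 2 ^ n := by
        have : 1 / 2 ≤ ‖w‖ := hw1.le.trans ((le_abs_self _).trans (Complex.abs_re_le_norm w))
        calc ‖w‖ ^ (1 / 2 - w.re) ≤ (1 / 2 : ℝ) ^ (1 / 2 - w.re) :=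
              Real.rpow_le_rpow_of_nonpos (by norm_num) this (by linarith)
          _ ≤ (1 / 2 : ℝ) ^ (-(n : ℝ)) :=
              Real.rpow_le_rpow_of_exponent_ge (by norm_num) (by norm_num) (by linarith)
          _ = 2 ^ n := by
            rw [Real.rpow_neg (by norm_num), Real.rpow_natCast]; simp
      have e3 : Real.exp (w.im * w.arg) ≤
          Real.exp (n * Real.exp (Real.pi / (2 * n) * |w.im|)) := by
        refine Real.exp_le_exp.mpr ((Complex.im_mul_arg_le (by linarith)).trans ?_)
        have := Real.add_one_le_exp (Real.pi / (2 * n) * |w.im|)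
        calc Real.pi * |w.im| / 2 = n * (Real.pi / (2 * n) * |w.im|) := by field_simp
          _ ≤ _ := by gcongr; linarith
      rw [norm_mul, Complex.norm_cpow_half_sub_self hw0, Real.norm_of_nonneg (Real.exp_pos _).le,
        ← mul_assoc]
      have hM0 : 0 ≤ M := (norm_nonneg _).trans e1
      gcongr

/-- Stirling-type upper bound for the Gamma function in vertical strips of the right half-plane. -/
theorem Complex.norm_Gamma_le {a : ℝ} (b : ℝ) (ha : 0 < a) : ∃ C : ℝ, 0 < C ∧ ∀ z : ℂ, a ≤ z.re →
    z.re ≤ b →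
    ‖Gamma z‖ ≤ C * (1 + |z.im|) ^ (z.re - 1 / 2) * Real.exp (-(Real.pi * |z.im| / 2)) := by
  obtain ⟨n, hn⟩ := exists_nat_gt (max 1 (b + 1))
  have hn1 : (1 : ℝ) < n := (le_max_left _ _).trans_lt hn
  have hn2 : b + 1 < n := (le_max_right _ _).trans_lt hn
  obtain ⟨C, hC, h⟩ := Complex.norm_Gamma_mul_cpow_le n (by
    have : (0 : ℝ) < n := by linarith
    exact_mod_cast this)
  have key : ∀ z : ℂ, 1 / 2 ≤ z.re → z.re ≤ n + 1 / 2 → ‖Gamma z‖ ≤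
      C * Real.exp (Real.pi * (n + 1 / 2) / 2) * (n + 1 / 2) ^ (n : ℝ) *
        ((1 + |z.im|) ^ (z.re - 1 / 2) * Real.exp (-(Real.pi * |z.im| / 2))) := by
    intro z h1 h2
    have hz0 : z ≠ 0 := by rintro rfl; simp at h1; linarith
    have hzn : 0 < ‖z‖ := norm_pos_iff.mpr hz0
    have e := h z h1 h2
    rw [norm_mul, Complex.norm_cpow_half_sub_self hz0] at e
    have e1 := Complex.le_im_mul_arg (z := z) (by linarith)
    have e2 := Complex.norm_le_mul_one_add_abs_im (b := n + 1 / 2) (by linarith) (z := z)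
      (by linarith) h2
    have e3 : ‖z‖ ^ (z.re - 1 / 2) * ‖z‖ ^ (1 / 2 - z.re) = 1 := by
      rw [← Real.rpow_add hzn]; simp
    have e4 : Real.exp (z.im * z.arg) * Real.exp (-(z.im * z.arg)) = 1 := by
      rw [← Real.exp_add]; simp
    calc ‖Gamma z‖ = ‖Gamma z‖ * (‖z‖ ^ (1 / 2 - z.re) * Real.exp (z.im * z.arg)) *
          (‖z‖ ^ (z.re - 1 / 2) * Real.exp (-(z.im * z.arg))) := by
          linear_combination (-‖Gamma z‖ * Real.exp (z.im * z.arg) *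
            Real.exp (-(z.im * z.arg))) * e3 - ‖Gamma z‖ * e4
      _ ≤ C * (((n + 1 / 2) * (1 + |z.im|)) ^ (z.re - 1 / 2) *
          Real.exp (Real.pi * (n + 1 / 2) / 2 + -(Real.pi * |z.im| / 2))) := by
          gcongr
          nlinarith [Real.pi_pos]
      _ ≤ C * (((n + 1 / 2) ^ (n : ℝ) * (1 + |z.im|) ^ (z.re - 1 / 2)) *
          Real.exp (Real.pi * (n + 1 / 2) / 2 + -(Real.pi * |z.im| / 2))) := by
          rw [Real.mul_rpow (by positivity) (by positivity)]
          gcongr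
          · linarith
          · linarith
      _ = _ := by rw [Real.exp_add]; ring
  set D := C * Real.exp (Real.pi * (n + 1 / 2) / 2) * (n + 1 / 2) ^ (n : ℝ) with hD
  have hD0 : 0 < D := by positivity
  refine ⟨D * (1 + 1 / a), by positivity, fun z h1 h2 => ?_⟩
  have hz0 : z ≠ 0 := by rintro rfl; simp at h1; linarith
  have hzn : 0 < ‖z‖ := norm_pos_iff.mpr hz0
  -- The bound is known only for real part at least 1/2; the functional equation carries it down to
  -- Re z ≥ a, and division by z costs the factor 1 + 1/a.
  have hk := key (z + 1) (by simp; linarith) (by simp; linarith)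
  rw [Complex.Gamma_add_one _ hz0, norm_mul] at hk
  simp only [Complex.add_re, Complex.one_re, Complex.add_im, Complex.one_im, add_zero] at hk
  have hi := Complex.one_add_abs_im_le ha h1
  have hp : (0 : ℝ) < 1 + |z.im| := by positivity
  rw [show z.re + 1 - 1 / 2 = (z.re - 1 / 2) + 1 by ring, Real.rpow_add_one hp.ne'] at hk
  refine le_of_mul_le_mul_left (hk.trans ?_) hzn
  calc D * ((1 + |z.im|) ^ (z.re - 1 / 2) * (1 + |z.im|) * Real.exp (-(Real.pi * |z.im| / 2)))
      ≤ D * ((1 + |z.im|) ^ (z.re - 1 / 2) * ((1 + 1 / a) * ‖z‖) *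
        Real.exp (-(Real.pi * |z.im| / 2))) := by gcongr
    _ = _ := by ring

/-! ### Contour shift. -/

/-- Shifting the contour of integration from `ℝ` to `ℝ + i`. -/
theorem Complex.integral_add_I_eq {F : ℂ → ℂ} {C : ℝ}
    (hF : DifferentiableOn ℂ F {s | 0 ≤ s.im ∧ s.im ≤ 1})
    (hC : ∀ s : ℂ, 0 ≤ s.im → s.im ≤ 1 → ‖F s‖ ≤ C * (1 + |s.re|) ^ (-2 : ℝ)) :
    ∫ t : ℝ, F t = ∫ t : ℝ, F (t + Complex.I) := by
  have hint : Integrable fun t : ℝ => C * (1 + |t|) ^ (-2 : ℝ) := by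
    have := (integrable_one_add_norm (E := ℝ) (μ := volume) (r := 2) (by simp)).const_mul C
    simpa using this
  have h0 : Integrable fun t : ℝ => F t := by
    refine hint.mono' (Continuous.aestronglyMeasurable ?_) (Eventually.of_forall fun t => ?_)
    · exact hF.continuousOn.comp_continuous (by fun_prop) (by simp)
    · simpa using hC t (by simp) (by simp)
  have h1 : Integrable fun t : ℝ => F (t + Complex.I) := by
    refine hint.mono' (Continuous.aestronglyMeasurable ?_) (Eventually.of_forall fun t => ?_)
    · exact hF.continuousOn.comp_continuous (by fun_prop) (by simp)
    · simpa using hC (t + Complex.I) (by simp) (by simp)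
  have hrect : ∀ T : ℝ, (∫ x in (-T)..T, F x) - (∫ x in (-T)..T, F (x + Complex.I)) +
      Complex.I • (∫ y in (0 : ℝ)..1, F (T + y * Complex.I)) -
      Complex.I • (∫ y in (0 : ℝ)..1, F (-T + y * Complex.I)) = 0 := by
    intro T
    have := Complex.integral_boundary_rect_eq_zero_of_differentiableOn F (-T) (T + Complex.I)
      (hF.mono fun s hs => by
        have := hs.2
        simpa using this)
    simpa using this
  -- The sign σ = ±1 treats both vertical sides of the rectangle at once.
  have hvert : ∀ σ : ℝ, |σ| = 1 → Tendsto
      (fun T : ℝ => ∫ y in (0 : ℝ)..1, F ((σ * T : ℝ) + y * Complex.I)) atTop (𝓝 0) := by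
    intro σ hσ
    have ht : Tendsto (fun T : ℝ => C * (1 + |T|) ^ (-2 : ℝ)) atTop (𝓝 0) := by
      have h := (tendsto_rpow_neg_atTop (y := 2) (by norm_num)).comp
        (tendsto_atTop_add_const_left atTop (1 : ℝ) tendsto_abs_atTop_atTop)
      simpa using h.const_mul C
    refine squeeze_zero_norm (fun T => ?_) ht
    refine (intervalIntegral.norm_integral_le_of_norm_le_const
      (C := C * (1 + |T|) ^ (-2 : ℝ)) fun y hy => ?_).trans (by simp)
    rw [Set.uIoc_of_le zero_le_one] at hy
    have := hC ((σ * T : ℝ) + y * Complex.I) (by simpa using hy.1.le) (by simpa using hy.2)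
    have hre : (((σ * T : ℝ) : ℂ) + y * Complex.I).re = σ * T := by simp
    rwa [hre, abs_mul, hσ, one_mul] at this
  have hlim := (((intervalIntegral_tendsto_integral h0 tendsto_neg_atTop_atBot tendsto_id).sub
    (intervalIntegral_tendsto_integral h1 tendsto_neg_atTop_atBot tendsto_id)).add
    ((hvert 1 (by simp)).const_smul Complex.I)).sub ((hvert (-1) (by simp)).const_smul Complex.I)
  simp only [id, one_mul, neg_mul, Complex.ofReal_neg, hrect, smul_zero, add_zero, sub_zero]
    at hlim
  exact sub_eq_zero.mp (tendsto_nhds_unique tendsto_const_nhds hlim).symm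

/-! ### Growth bounds and square integrability. -/

namespace Vilenkin

/-- The operator `f ↦ (α/2 + is) f(s - i)`. -/
def shiftDown (α : ℝ) (f : ℂ → ℂ) (s : ℂ) : ℂ :=
  (α / 2 + Complex.I * s) * f (s - Complex.I)

/-- The operator `f ↦ (α/2 - is) f(s + i)`. -/
def shiftUp (α : ℝ) (f : ℂ → ℂ) (s : ℂ) : ℂ :=
  (α / 2 - Complex.I * s) * f (s + Complex.I)

/-- Multiplication by the variable. -/
def mulVar (f : ℂ → ℂ) (s : ℂ) : ℂ := s * f s

/-- The difference expression with an arbitrary coefficient `c` in place of `2 cosh φ`. -/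
def diffOp (α c : ℝ) (f : ℂ → ℂ) (s : ℂ) : ℂ :=
  Complex.I * shiftDown α f s + c * mulVar f s - Complex.I * shiftUp α f s

theorem differenceExpr_eq_diffOp (α φ : ℝ) (f : ℂ → ℂ) :
    differenceExpr α φ f = diffOp α (2 * Real.cosh φ) f := by
  ext s
  simp only [differenceExpr, diffOp, shiftDown, shiftUp, mulVar]
  push_cast
  ring

theorem Psi_rpow (α : ℝ) {s : ℂ} (hs : s ≠ 0) (ε : ℝ) :
    Psi α s ^ (-(1 / 2) : ℝ) * ‖s‖ ^ (-(3 / 2) - ε) =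
      ‖s‖ ^ (-1 - α / 2 - ε) * Real.exp (Real.pi * (|s.re| - s.re) / 2) := by
  have hn : 0 < ‖s‖ := norm_pos_iff.mpr hs
  rw [Psi, Real.mul_rpow (by positivity) (by positivity), ← Real.rpow_mul hn.le, ← Real.exp_mul,
    mul_right_comm, ← Real.rpow_add hn]
  ring_nf

/-- The estimate at infinity becomes global because the part of the closed strip in a ball is
compact. -/
theorem bound_of_mem_H {α : ℝ} (hα : 0 < α) {f : ℂ → ℂ} (hf : f ∈ H α) :
    ∃ C ε : ℝ, 0 < C ∧ 0 < ε ∧ ∀ s : ℂ, |s.im| ≤ 1 →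
      ‖f s‖ ≤ C * (1 + |s.re|) ^ (-1 - α / 2 - ε) *
        Real.exp (Real.pi * (|s.re| - s.re) / 2) := by
  obtain ⟨⟨δ, hδ, hd⟩, ε, hε, hO⟩ := hf
  obtain ⟨K, hK, hO⟩ := hO.exists_pos
  rw [IsBigOWith, eventually_inf_principal,
    (Metric.hasBasis_cobounded_compl_closedBall (0 : ℂ)).eventually_iff] at hO
  obtain ⟨R₀, -, hR₀⟩ := hO
  set R := max R₀ 1
  have hcompact : IsCompact (Metric.closedBall (0 : ℂ) R ∩ {s | |s.im| ≤ 1}) :=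
    (isCompact_closedBall _ _).inter_right (isClosed_le (by fun_prop) continuous_const)
  obtain ⟨M, hM⟩ := hcompact.exists_bound_of_continuousOn
    (hd.continuousOn.mono fun s hs =>
      (hs.2 : |s.im| ≤ 1).trans_lt (by linarith : (1 : ℝ) < 1 + δ))
  set p := -1 - α / 2 - ε with hp
  have hp0 : p ≤ 0 := by rw [hp]; linarith
  have hR1 : 1 ≤ R := le_max_right _ _
  -- The first constant serves ‖s‖ ≤ R. The second serves ‖s‖ > R ≥ 1, where ‖s‖ ≥ (1 + |Re s|)/2;
  -- both use p ≤ 0.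
  refine ⟨|M| * (1 + R) ^ (-p) + K * 2 ^ (-p), ε, by positivity, hε, fun s hs => ?_⟩
  have hexp : 1 ≤ Real.exp (Real.pi * (|s.re| - s.re) / 2) := by
    rw [Real.one_le_exp_iff]
    have := le_abs_self s.re
    have := Real.pi_pos
    have : 0 ≤ Real.pi * (|s.re| - s.re) := mul_nonneg (by linarith) (by linarith)
    linarith
  have hre := Complex.abs_re_le_norm s
  rw [add_mul, add_mul]
  by_cases hsR : ‖s‖ ≤ R
  · have h1 : ‖f s‖ ≤ |M| := (hM s ⟨by simpa using hsR, hs⟩).trans (le_abs_self M)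
    refine le_trans ?_ (le_add_of_nonneg_right (by positivity))
    have h2 : (1 + R) ^ p ≤ (1 + |s.re|) ^ p :=
      Real.rpow_le_rpow_of_nonpos (by positivity) (by linarith) hp0
    have h3 : (1 + R) ^ (-p) * (1 + R) ^ p = 1 := by
      rw [← Real.rpow_add (by positivity)]; simp
    calc ‖f s‖ ≤ |M| * ((1 + R) ^ (-p) * (1 + R) ^ p) * 1 := by rw [h3]; simpa using h1
      _ ≤ |M| * ((1 + R) ^ (-p) * (1 + |s.re|) ^ p) *
          Real.exp (Real.pi * (|s.re| - s.re) / 2) := by gcongr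
      _ = _ := by ring
  · push Not at hsR
    have hs0 : s ≠ 0 := by rintro rfl; simp at hsR; linarith
    have h1 := hR₀ (x := s) (by simpa using (le_max_left _ _).trans_lt hsR) hs
    rw [Psi_rpow α hs0, Real.norm_of_nonneg (by positivity)] at h1
    refine le_trans ?_ (le_add_of_nonneg_left (by positivity))
    have h2 : ‖s‖ ^ p ≤ ((1 + |s.re|) / 2) ^ p :=
      Real.rpow_le_rpow_of_nonpos (by positivity) (by linarith) hp0
    rw [Real.div_rpow (by positivity) (by positivity), div_eq_mul_inv,
      ← Real.rpow_neg (by norm_num)] at h2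
    calc ‖f s‖ ≤ _ := h1
      _ ≤ K * (((1 + |s.re|) ^ p * 2 ^ (-p)) *
          Real.exp (Real.pi * (|s.re| - s.re) / 2)) := by gcongr
      _ = _ := by ring

theorem weight_le {α : ℝ} (hα : 0 < α) : ∃ C : ℝ, 0 < C ∧ ∀ t : ℝ,
    weight α t ≤ C * (1 + |t|) ^ (α - 1) * Real.exp (-(Real.pi * (|t| - t))) := by
  obtain ⟨C, hC, h⟩ := Complex.norm_Gamma_le (a := α / 2) (α / 2) (by positivity)
  refine ⟨1 / (2 * Real.pi) * C ^ 2, by have := Real.pi_pos; positivity, fun t => ?_⟩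
  have := h (α / 2 + Complex.I * t) (by simp) (by simp)
  simp only [Complex.add_im, Complex.add_re, Complex.mul_im, Complex.mul_re, Complex.I_re,
    Complex.I_im, Complex.ofReal_re, Complex.ofReal_im, Complex.div_ofNat_re,
    Complex.div_ofNat_im] at this
  norm_num at this
  have hq : (0 : ℝ) < 1 + |t| := by positivity
  have h2 : ((1 + |t|) ^ (α / 2 - 1 / 2)) ^ 2 = (1 + |t|) ^ (α - 1) := by
    rw [← Real.rpow_mul_natCast hq.le]; congr 1; push_cast; ring
  have h3 : Real.exp (-(Real.pi * |t| / 2)) ^ 2 * Real.exp (Real.pi * t) =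
      Real.exp (-(Real.pi * (|t| - t))) := by
    rw [← Real.exp_nat_mul, ← Real.exp_add]; congr 1; push_cast; ring
  have hpi := Real.pi_pos
  calc weight α t = 1 / (2 * Real.pi) * ‖Complex.Gamma (α / 2 + Complex.I * t)‖ ^ 2 *
        Real.exp (Real.pi * t) := rfl
    _ ≤ 1 / (2 * Real.pi) * (C * (1 + |t|) ^ (α / 2 - 1 / 2) *
        Real.exp (-(Real.pi * |t| / 2))) ^ 2 * Real.exp (Real.pi * t) := by gcongr
    _ = _ := by rw [← h3, mul_pow, mul_pow, h2]; ring

theorem integrable_weightMeasure_iff {α : ℝ} (hα : 0 < α) {E : Type*} [NormedAddCommGroup E]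
    [NormedSpace ℝ E] {g : ℝ → E} :
    Integrable g (weightMeasure α) ↔ Integrable fun t => weight α t • g t := by
  rw [weightMeasure, integrable_withDensity_iff_integrable_smul₀'
    (measurable_weight hα).ennreal_ofReal.aemeasurable (by simp)]
  simp only [ENNReal.toReal_ofReal (weight_pos hα _).le]

theorem integral_weightMeasure {α : ℝ} (hα : 0 < α) {E : Type*} [NormedAddCommGroup E]
    [NormedSpace ℝ E] (g : ℝ → E) :
    ∫ t, g t ∂weightMeasure α = ∫ t, weight α t • g t := by
  rw [weightMeasure, integral_withDensity_eq_integral_toReal_smul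
    (measurable_weight hα).ennreal_ofReal (by simp)]
  simp only [ENNReal.toReal_ofReal (weight_pos hα _).le]

/-- The hypothesis balances `weight_le`: the exponentials cancel and the powers leave (1 +
|t|)^(-1-2ε), which is integrable. -/
theorem memLp_of_bound {α : ℝ} (hα : 0 < α) {g : ℝ → ℂ} (hg : Continuous g) {C ε : ℝ}
    (hε : 0 < ε) (h : ∀ t, ‖g t‖ ≤ C * (1 + |t|) ^ (-(α / 2) - ε) *
      Real.exp (Real.pi * (|t| - t) / 2)) :
    MemLp g 2 (weightMeasure α) := by
  rw [memLp_two_iff_integrable_sq_norm hg.aestronglyMeasurable, integrable_weightMeasure_iff hα]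
  obtain ⟨K, hK, hw⟩ := weight_le hα
  have hi := (integrable_one_add_norm (E := ℝ) (μ := volume) (r := 1 + 2 * ε)
    (by simp; linarith)).const_mul (K * C ^ 2)
  refine hi.mono' ((measurable_weight hα).aestronglyMeasurable.smul
    (by fun_prop)) (Eventually.of_forall fun t => ?_)
  have hw0 := (weight_pos hα t).le
  have hq : (0 : ℝ) < 1 + |t| := by positivity
  rw [Real.norm_of_nonneg (by positivity), smul_eq_mul, Real.norm_eq_abs]
  have e1 : ((1 + |t|) ^ (-(α / 2) - ε)) ^ 2 * (1 + |t|) ^ (α - 1) =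
      (1 + |t|) ^ (-(1 + 2 * ε)) := by
    rw [← Real.rpow_mul_natCast hq.le, ← Real.rpow_add hq]; congr 1; push_cast; ring
  have e2 : Real.exp (-(Real.pi * (|t| - t))) * Real.exp (Real.pi * (|t| - t) / 2) ^ 2 = 1 := by
    rw [← Real.exp_nat_mul, ← Real.exp_add, Real.exp_eq_one_iff]; push_cast; ring
  calc weight α t * ‖g t‖ ^ 2 ≤ (K * (1 + |t|) ^ (α - 1) * Real.exp (-(Real.pi * (|t| - t)))) *
        (C * (1 + |t|) ^ (-(α / 2) - ε) * Real.exp (Real.pi * (|t| - t) / 2)) ^ 2 := by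
        gcongr
        · exact hw t
        · exact h t
    _ = K * C ^ 2 * (((1 + |t|) ^ (-(α / 2) - ε)) ^ 2 * (1 + |t|) ^ (α - 1)) *
        (Real.exp (-(Real.pi * (|t| - t))) * Real.exp (Real.pi * (|t| - t) / 2) ^ 2) := by ring
    _ = _ := by rw [e1, e2, mul_one]

theorem continuous_of_mem_H {α : ℝ} {f : ℂ → ℂ} (hf : f ∈ H α) {y : ℂ} (hy : |y.im| ≤ 1) :
    Continuous fun t : ℝ => f (t + y) := by
  obtain ⟨⟨δ, hδ, hd⟩, -⟩ := hf
  refine hd.continuousOn.comp_continuous (by fun_prop) fun t => ?_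
  simpa using lt_of_le_of_lt hy (by linarith)

/-- Every term of the difference expression has this form. The linear factor uses up one power of
decay, exactly the margin that `bound_of_mem_H` has over `memLp_of_bound`. -/
theorem memLp_linear_mul {α : ℝ} (hα : 0 < α) {f : ℂ → ℂ} (hf : f ∈ H α) {y : ℂ}
    (hy : |y.im| ≤ 1) (hy' : y.re = 0) (a b : ℂ) :
    MemLp (fun t : ℝ => (a + b * t) * f (t + y)) 2 (weightMeasure α) := by
  obtain ⟨C, ε, hC, hε, h⟩ := bound_of_mem_H hα hf
  refine memLp_of_bound hα ((by fun_prop : Continuous fun t : ℝ => a + b * (t : ℂ)).mul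
    (continuous_of_mem_H hf hy)) (C := (‖a‖ + ‖b‖) * C) hε fun t => ?_
  have hq : (0 : ℝ) < 1 + |t| := by positivity
  have h1 := h (t + y) (by simpa using hy)
  simp only [Complex.add_re, Complex.ofReal_re, hy', add_zero] at h1
  have h2 : ‖a + b * t‖ ≤ (‖a‖ + ‖b‖) * (1 + |t|) := by
    have := norm_add_le a (b * t)
    rw [norm_mul, Complex.norm_real, Real.norm_eq_abs] at this
    nlinarith [norm_nonneg a, norm_nonneg b, abs_nonneg t]
  rw [norm_mul]
  calc _ ≤ _ := mul_le_mul h2 h1 (norm_nonneg _) (by positivity)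
    _ = _ := by
      rw [show -(α / 2) - ε = (-1 - α / 2 - ε) + 1 by ring, Real.rpow_add_one hq.ne']
      ring

theorem memLp_of_mem_H {α : ℝ} (hα : 0 < α) {f : ℂ → ℂ} (hf : f ∈ H α) :
    MemLp (fun t : ℝ => f t) 2 (weightMeasure α) := by
  simpa using memLp_linear_mul hα hf (y := 0) (by simp) rfl 1 0

theorem memLp_mulVar {α : ℝ} (hα : 0 < α) {f : ℂ → ℂ} (hf : f ∈ H α) :
    MemLp (fun t : ℝ => mulVar f t) 2 (weightMeasure α) := by
  simpa [mulVar] using memLp_linear_mul hα hf (y := 0) (by simp) rfl 0 1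

theorem memLp_shiftDown {α : ℝ} (hα : 0 < α) {f : ℂ → ℂ} (hf : f ∈ H α) :
    MemLp (fun t : ℝ => shiftDown α f t) 2 (weightMeasure α) := by
  simpa [shiftDown, sub_eq_add_neg] using
    memLp_linear_mul hα hf (y := -Complex.I) (by simp) (by simp) (α / 2) Complex.I

theorem memLp_shiftUp {α : ℝ} (hα : 0 < α) {f : ℂ → ℂ} (hf : f ∈ H α) :
    MemLp (fun t : ℝ => shiftUp α f t) 2 (weightMeasure α) := by
  simpa [shiftUp, sub_eq_add_neg] using
    memLp_linear_mul hα hf (y := Complex.I) (by simp) (by simp) (α / 2) (-Complex.I)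

theorem memLp_diffOp {α : ℝ} (hα : 0 < α) (c : ℝ) {f : ℂ → ℂ} (hf : f ∈ H α) :
    MemLp (fun t : ℝ => diffOp α c f t) 2 (weightMeasure α) :=
  (((memLp_shiftDown hα hf).const_smul Complex.I).add
    ((memLp_mulVar hα hf).const_smul (c : ℂ))).sub ((memLp_shiftUp hα hf).const_smul Complex.I)

/-! ### Symmetry of the difference operator. -/

/-- The reflected function `s ↦ conj (f (conj s))`. -/
def reflect (f : ℂ → ℂ) : ℂ → ℂ := starRingEnd ℂ ∘ f ∘ starRingEnd ℂ

theorem reflect_mem_H {α : ℝ} {f : ℂ → ℂ} (hf : f ∈ H α) : reflect f ∈ H α := by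
  obtain ⟨⟨δ, hδ, hd⟩, ε, hε, hO⟩ := hf
  have hopen : IsOpen {s : ℂ | |s.im| < 1 + δ} := isOpen_lt (by fun_prop) continuous_const
  refine ⟨⟨δ, hδ, fun s hs => ?_⟩, ε, hε, ?_⟩
  · refine DifferentiableAt.differentiableWithinAt ?_
    rw [reflect, differentiableAt_conj_conj_iff]
    exact hd.differentiableAt (hopen.mem_nhds (by simpa using hs))
  · have ht : Tendsto (starRingEnd ℂ) (Bornology.cobounded ℂ ⊓ 𝓟 {s : ℂ | |s.im| ≤ 1})
        (Bornology.cobounded ℂ ⊓ 𝓟 {s : ℂ | |s.im| ≤ 1}) := by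
      refine tendsto_inf.mpr ⟨tendsto_inf_left ?_, tendsto_inf_right ?_⟩
      · rw [← tendsto_norm_atTop_iff_cobounded]
        simpa using tendsto_norm_cobounded_atTop (E := ℂ)
      · exact tendsto_principal_principal.mpr fun s hs => by simpa using hs
    have h := hO.comp_tendsto ht
    have hc : (fun s : ℂ => Psi α s ^ (-(1 / 2) : ℝ) * ‖s‖ ^ (-(3 / 2) - ε)) ∘ starRingEnd ℂ =
        fun s : ℂ => Psi α s ^ (-(1 / 2) : ℝ) * ‖s‖ ^ (-(3 / 2) - ε) := by
      ext s; simp [Psi]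
    rw [hc, ← isBigO_norm_left] at h
    rw [← isBigO_norm_left]
    simpa [reflect] using h

/-- On ℝ, conj (g t) equals the holomorphic function `reflect g`, so the integrand extends to the
strip 0 ≤ Im s ≤ 1. Moving to ℝ + i turns f(t - i) into f(t) and conj (g t) into conj (g (t - i));
the minus sign is exp(πi). -/
theorem integral_shiftDown {α : ℝ} (hα : 0 < α) {f g : ℂ → ℂ} (hf : f ∈ H α) (hg : g ∈ H α) :
    ∫ t, (starRingEnd ℂ) (g t) * shiftDown α f t ∂weightMeasure α =
      -∫ t, (starRingEnd ℂ) (shiftDown α g t) * f t ∂weightMeasure α := by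
  -- `W` continues (α/2 + is) w(s). Writing the product as Γ(α/2 + 1 + is) removes the pole of Γ(α/2
  -- + is) at s = iα/2, which may lie in the strip.
  set W : ℂ → ℂ := fun s => 1 / (2 * Real.pi) * (Complex.Gamma (α / 2 + 1 + Complex.I * s) *
    Complex.Gamma (α / 2 - Complex.I * s)) * Complex.exp (Real.pi * s) with hW
  have hG : ∀ t : ℝ, Complex.Gamma (α / 2 - Complex.I * t) =
      (starRingEnd ℂ) (Complex.Gamma (α / 2 + Complex.I * t)) := by
    intro t
    rw [← Complex.Gamma_conj]; congr 1; simp [Complex.conj_ofReal, map_ofNat (starRingEnd ℂ) 2]; ring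
  have hw : ∀ t : ℝ, ((weight α t : ℝ) : ℂ) = 1 / (2 * Real.pi) *
      (Complex.Gamma (α / 2 + Complex.I * t) * Complex.Gamma (α / 2 - Complex.I * t)) *
        Complex.exp (Real.pi * t) := by
    intro t
    rw [hG, Complex.mul_conj, Complex.normSq_eq_norm_sq, weight]
    push_cast
    ring
  have hne : ∀ t : ℝ, (α / 2 + Complex.I * t : ℂ) ≠ 0 ∧ (α / 2 - Complex.I * t : ℂ) ≠ 0 := by
    intro t
    constructor <;> intro h <;> have := congrArg Complex.re h <;> simp at this <;> linarith
  have hW0 : ∀ t : ℝ, W t = (α / 2 + Complex.I * t) * weight α t := by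
    intro t
    rw [hw, hW]
    simp only
    rw [add_right_comm, Complex.Gamma_add_one _ (hne t).1]
    ring
  have hW1 : ∀ t : ℝ, W (t + Complex.I) = -((α / 2 - Complex.I * t) * weight α t) := by
    intro t
    rw [hw, hW]
    simp only
    rw [show (α / 2 + 1 + Complex.I * (t + Complex.I) : ℂ) = α / 2 + Complex.I * t by
        linear_combination Complex.I_mul_I,
      show (α / 2 - Complex.I * (t + Complex.I) : ℂ) = α / 2 - Complex.I * t + 1 by
        linear_combination -Complex.I_mul_I,
      Complex.Gamma_add_one _ (hne t).2, mul_add, Complex.exp_add, Complex.exp_pi_mul_I]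
    ring
  have hgr := reflect_mem_H hg
  obtain ⟨C₁, ε₁, hC₁, hε₁, h₁⟩ := bound_of_mem_H hα hf
  obtain ⟨C₂, ε₂, hC₂, hε₂, h₂⟩ := bound_of_mem_H hα hgr
  obtain ⟨K, hK, hΓ⟩ := Complex.norm_Gamma_le (a := α / 2) (α / 2 + 1) (by positivity)
  have key := Complex.integral_add_I_eq (F := fun s => W s * f (s - Complex.I) * reflect g s)
    (C := 1 / (2 * Real.pi) * K ^ 2 * C₁ * C₂) ?_ ?_
  · rw [integral_weightMeasure hα, integral_weightMeasure hα, ← integral_neg]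
    refine Eq.trans (integral_congr_ae (Eventually.of_forall fun t => ?_)) (key.trans
      (integral_congr_ae (Eventually.of_forall fun t => ?_)))
    · simp only [hW0, shiftDown, reflect, Function.comp, Complex.real_smul, Complex.conj_ofReal]
      ring
    · simp only [hW1, shiftDown, reflect, Function.comp, Complex.real_smul, Complex.conj_ofReal,
        map_mul, map_add, Complex.conj_I, add_sub_cancel_right, map_div₀, map_ofNat]
      rw [show ((t : ℂ) + -Complex.I) = t - Complex.I by ring]
      ring
  · obtain ⟨⟨δ₁, hδ₁, hd₁⟩, -⟩ := hf
    obtain ⟨⟨δ₂, hδ₂, hd₂⟩, -⟩ := hgr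
    have hopen : ∀ δ : ℝ, IsOpen {s : ℂ | |s.im| < 1 + δ} := fun δ =>
      isOpen_lt (by fun_prop) continuous_const
    have hΓd : ∀ z : ℂ, 0 < z.re → DifferentiableAt ℂ Complex.Gamma z := by
      intro z hz
      refine Complex.differentiableAt_Gamma _ fun m hm => ?_
      have h2 := congrArg Complex.re hm
      simp at h2
      have : (0 : ℝ) ≤ m := m.cast_nonneg
      linarith
    intro s hs
    refine DifferentiableAt.differentiableWithinAt ?_
    have e1 : DifferentiableAt ℂ (fun s : ℂ => Complex.Gamma (α / 2 + 1 + Complex.I * s)) s :=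
      DifferentiableAt.comp (f := fun s : ℂ => (α / 2 + 1 + Complex.I * s : ℂ)) s
        (hΓd _ (by simp; linarith [hs.2])) (by fun_prop)
    have e2 : DifferentiableAt ℂ (fun s : ℂ => Complex.Gamma (α / 2 - Complex.I * s)) s :=
      DifferentiableAt.comp (f := fun s : ℂ => (α / 2 - Complex.I * s : ℂ)) s
        (hΓd _ (by simp; linarith [hs.1])) (by fun_prop)
    have e3 : DifferentiableAt ℂ (fun s : ℂ => f (s - Complex.I)) s :=
      DifferentiableAt.comp (f := fun s : ℂ => s - Complex.I) s
        (hd₁.differentiableAt ((hopen δ₁).mem_nhds (by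
          simp only [Set.mem_ofPred_eq, Complex.sub_im, Complex.I_im]
          rw [abs_lt]; constructor <;> linarith [hs.1, hs.2]))) (by fun_prop)
    have e4 : DifferentiableAt ℂ (reflect g) s :=
      hd₂.differentiableAt ((hopen δ₂).mem_nhds (by
          simp only [Set.mem_ofPred_eq]
          rw [abs_lt]; constructor <;> linarith [hs.1, hs.2]))
    exact ((((e1.mul e2).const_mul _).mul (by fun_prop)).mul e3).mul e4
  · intro s h0 h1
    have hpi := Real.pi_pos
    have hq : (1 : ℝ) ≤ 1 + |s.re| := by simp
    have hq0 : (0 : ℝ) < 1 + |s.re| := by positivity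
    have b1 := hΓ (α / 2 + 1 + Complex.I * s) (by simp; linarith) (by simp; linarith)
    have b2 := hΓ (α / 2 - Complex.I * s) (by simp; linarith) (by simp; linarith)
    have i1 : (α / 2 + 1 + Complex.I * s : ℂ).im = s.re := by simp
    have r1 : (α / 2 + 1 + Complex.I * s : ℂ).re = α / 2 + 1 - s.im := by simp; ring
    have i2 : (α / 2 - Complex.I * s : ℂ).im = -s.re := by simp
    have r2 : (α / 2 - Complex.I * s : ℂ).re = α / 2 + s.im := by simp
    rw [i1, r1] at b1
    rw [i2, r2, abs_neg] at b2
    have b3 := h₁ (s - Complex.I) (by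
      simp only [Complex.sub_im, Complex.I_im]; rw [abs_le]; constructor <;> linarith)
    have b4 := h₂ s (by rw [abs_le]; constructor <;> linarith)
    simp only [Complex.sub_re, Complex.I_re, sub_zero] at b3
    set q := 1 + |s.re| with hqdef
    have hpre : ‖(1 / (2 * Real.pi) : ℂ)‖ = 1 / (2 * Real.pi) := by
      rw [show (1 / (2 * Real.pi) : ℂ) = ((1 / (2 * Real.pi) : ℝ) : ℂ) by push_cast; rfl,
        Complex.norm_real, Real.norm_of_nonneg (by positivity)]
    have hexp : ‖Complex.exp (Real.pi * s)‖ = Real.exp (Real.pi * s.re) := by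
      simp [Complex.norm_exp]
    -- The contributions of Im s from the two Gamma factors cancel, and the total exponent is -2 -
    -- ε₁ - ε₂.
    have c1 : q ^ (α / 2 + 1 - s.im - 1 / 2) * q ^ (α / 2 + s.im - 1 / 2) *
        (q ^ (-1 - α / 2 - ε₁) * q ^ (-1 - α / 2 - ε₂)) ≤ q ^ (-2 : ℝ) := by
      rw [← Real.rpow_add hq0, ← Real.rpow_add hq0, ← Real.rpow_add hq0]
      exact Real.rpow_le_rpow_of_exponent_le hq (by linarith)
    have c2 : Real.exp (-(Real.pi * |s.re| / 2)) ^ 2 * Real.exp (Real.pi * s.re) *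
        Real.exp (Real.pi * (|s.re| - s.re) / 2) ^ 2 = 1 := by
      rw [← Real.exp_nat_mul, ← Real.exp_nat_mul, ← Real.exp_add, ← Real.exp_add,
        Real.exp_eq_one_iff]
      push_cast; ring
    simp only [hW, norm_mul, hpre, hexp]
    calc _ ≤ 1 / (2 * Real.pi) * ((K * q ^ (α / 2 + 1 - s.im - 1 / 2) *
            Real.exp (-(Real.pi * |s.re| / 2))) * (K * q ^ (α / 2 + s.im - 1 / 2) *
            Real.exp (-(Real.pi * |s.re| / 2)))) * Real.exp (Real.pi * s.re) *
            (C₁ * q ^ (-1 - α / 2 - ε₁) * Real.exp (Real.pi * (|s.re| - s.re) / 2)) *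
            (C₂ * q ^ (-1 - α / 2 - ε₂) * Real.exp (Real.pi * (|s.re| - s.re) / 2)) := by
          gcongr
      _ = 1 / (2 * Real.pi) * K ^ 2 * C₁ * C₂ *
          (q ^ (α / 2 + 1 - s.im - 1 / 2) * q ^ (α / 2 + s.im - 1 / 2) *
            (q ^ (-1 - α / 2 - ε₁) * q ^ (-1 - α / 2 - ε₂))) *
          (Real.exp (-(Real.pi * |s.re| / 2)) ^ 2 * Real.exp (Real.pi * s.re) *
            Real.exp (Real.pi * (|s.re| - s.re) / 2) ^ 2) := by ring
      _ ≤ _ := by rw [c2, mul_one]; gcongr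

/-- Reflection intertwines `shiftUp` with `shiftDown` on the real line, so this is the conjugate of
the previous identity. -/
theorem integral_shiftUp {α : ℝ} (hα : 0 < α) {f g : ℂ → ℂ} (hf : f ∈ H α) (hg : g ∈ H α) :
    ∫ t, (starRingEnd ℂ) (g t) * shiftUp α f t ∂weightMeasure α =
      -∫ t, (starRingEnd ℂ) (shiftUp α g t) * f t ∂weightMeasure α := by
  have h := congrArg (starRingEnd ℂ)
    (integral_shiftDown hα (reflect_mem_H hf) (reflect_mem_H hg))
  have hr : ∀ (f : ℂ → ℂ) (t : ℝ), shiftDown α (reflect f) t =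
      (starRingEnd ℂ) (shiftUp α f t) := by
    intro f t
    simp [shiftDown, shiftUp, reflect, Complex.conj_ofReal, map_ofNat (starRingEnd ℂ) 2]
  rw [map_neg, ← integral_conj, ← integral_conj] at h
  simp only [hr] at h
  simpa only [map_mul, Complex.conj_conj, reflect, Function.comp, Complex.conj_ofReal] using h

theorem integrable_conj_mul {α : ℝ} {f g : ℝ → ℂ} (hf : MemLp f 2 (weightMeasure α))
    (hg : MemLp g 2 (weightMeasure α)) :
    Integrable (fun t => (starRingEnd ℂ) (g t) * f t) (weightMeasure α) :=
  MemLp.integrable_mul hg.star hf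

theorem integral_diffOp {α : ℝ} (hα : 0 < α) (c : ℝ) {f g : ℂ → ℂ} (hf : f ∈ H α) (hg : g ∈ H α) :
    ∫ t, (starRingEnd ℂ) (g t) * diffOp α c f t ∂weightMeasure α =
      ∫ t, (starRingEnd ℂ) (diffOp α c g t) * f t ∂weightMeasure α := by
  have mf := memLp_of_mem_H hα hf
  have mg := memLp_of_mem_H hα hg
  have i1 := (integrable_conj_mul (memLp_shiftDown hα hf) mg).const_mul Complex.I
  have i2 := (integrable_conj_mul (memLp_mulVar hα hf) mg).const_mul (c : ℂ)
  have i3 := (integrable_conj_mul (memLp_shiftUp hα hf) mg).const_mul Complex.I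
  have j1 := (integrable_conj_mul mf (memLp_shiftDown hα hg)).const_mul (-Complex.I)
  have j2 := (integrable_conj_mul mf (memLp_mulVar hα hg)).const_mul (c : ℂ)
  have j3 := (integrable_conj_mul mf (memLp_shiftUp hα hg)).const_mul (-Complex.I)
  have e1 := integral_shiftDown hα hf hg
  have e2 : ∫ t, (starRingEnd ℂ) (g t) * mulVar f t ∂weightMeasure α =
      ∫ t, (starRingEnd ℂ) (mulVar g t) * f t ∂weightMeasure α := by
    congr 1; ext t; simp only [mulVar, map_mul, Complex.conj_ofReal]; ring
  have e3 := integral_shiftUp hα hf hg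
  have hl : (fun t : ℝ => (starRingEnd ℂ) (g t) * diffOp α c f t) = fun t : ℝ =>
      Complex.I * ((starRingEnd ℂ) (g t) * shiftDown α f t) +
        c * ((starRingEnd ℂ) (g t) * mulVar f t) -
        Complex.I * ((starRingEnd ℂ) (g t) * shiftUp α f t) := by
    ext t; simp only [diffOp]; ring
  have hr : (fun t : ℝ => (starRingEnd ℂ) (diffOp α c g t) * f t) = fun t : ℝ =>
      -Complex.I * ((starRingEnd ℂ) (shiftDown α g t) * f t) +
        c * ((starRingEnd ℂ) (mulVar g t) * f t) -
        -Complex.I * ((starRingEnd ℂ) (shiftUp α g t) * f t) := by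
    ext t
    simp only [diffOp, map_sub, map_add, map_mul, Complex.conj_I, Complex.conj_ofReal]; ring
  have hi : ∀ {a b c : ℝ → ℂ}, Integrable a (weightMeasure α) → Integrable b (weightMeasure α) →
      Integrable c (weightMeasure α) → ∫ t, a t + b t - c t ∂weightMeasure α =
        ∫ t, a t ∂weightMeasure α + ∫ t, b t ∂weightMeasure α - ∫ t, c t ∂weightMeasure α :=
    fun ha hb hc => (integral_sub (ha.add hb) hc).trans (by rw [← integral_add ha hb]; rfl)
  rw [hl, hr, hi i1 i2 i3, hi j1 j2 j3]
  simp only [integral_const_mul, e1, e2, e3]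
  ring

/-! ### L² classes and explicit elements of the domain. -/

/-- The class in `L²(ℝ, w(t) dt)` of a function in `𝓗[w]`. -/
def toL2 {α : ℝ} (hα : 0 < α) : H α →ₗ[ℂ] L2w α where
  toFun f := (memLp_of_mem_H hα f.2).toLp fun t : ℝ => f.1 t
  map_add' f g := MemLp.toLp_add (memLp_of_mem_H hα f.2) (memLp_of_mem_H hα g.2)
  map_smul' c f := MemLp.toLp_const_smul c (memLp_of_mem_H hα f.2)

theorem coeFn_toL2 {α : ℝ} (hα : 0 < α) (f : H α) :
    toL2 hα f =ᵐ[weightMeasure α] fun t : ℝ => f.1 t :=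
  MemLp.coeFn_toLp (memLp_of_mem_H hα f.2)

theorem inner_eq_integral {α : ℝ} {u v : L2w α} {f g : ℝ → ℂ}
    (hu : u =ᵐ[weightMeasure α] f) (hv : v =ᵐ[weightMeasure α] g) :
    inner ℂ u v = ∫ t, (starRingEnd ℂ) (f t) * g t ∂weightMeasure α := by
  rw [L2.inner_def]
  refine integral_congr_ae ?_
  filter_upwards [hu, hv] with t h1 h2
  rw [h1, h2, RCLike.inner_apply, mul_comm]

/-- The exponential margin π/2 - |b| absorbs every power. The value b = 0 serves the eigenfunctions,
and b = ±1 gives the exponential integrability needed for completeness. -/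
theorem pow_mul_exp_mem_H {α : ℝ} (n : ℕ) {b : ℝ} (hb : |b| < Real.pi / 2) :
    (fun s : ℂ => s ^ n * Complex.exp ((b - Real.pi / 2) * s)) ∈ H α := by
  refine ⟨⟨1, one_pos, by fun_prop⟩, 1, one_pos, ?_⟩
  have h := (isLittleO_rpow_exp_pos_mul_atTop (n + (1 + α / 2 + 1))
    (sub_pos.mpr hb)).isBigO.comp_tendsto (tendsto_norm_cobounded_atTop (E := ℂ))
  obtain ⟨K, hK, h⟩ := h.exists_pos
  refine IsBigO.of_bound (K * Real.exp (Real.pi / 2 - |b|)) ?_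
  filter_upwards [h.bound.filter_mono inf_le_left,
    (tendsto_norm_cobounded_atTop.eventually (eventually_ge_atTop 1)).filter_mono inf_le_left,
    mem_inf_of_right (mem_principal_self _)] with s h1 h2 h3
  have hs0 : s ≠ 0 := by rintro rfl; simp at h2; linarith
  have hn : 0 < ‖s‖ := norm_pos_iff.mpr hs0
  rw [Psi_rpow α hs0]
  simp only [Function.comp] at h1
  rw [Real.norm_of_nonneg (by positivity), Real.norm_of_nonneg (by positivity)] at h1
  rw [norm_mul, norm_pow, Complex.norm_exp, Real.norm_of_nonneg (by positivity)]
  have hre : (((b : ℂ) - Real.pi / 2) * s).re = (b - Real.pi / 2) * s.re := by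
    rw [show ((b : ℂ) - Real.pi / 2) = ((b - Real.pi / 2 : ℝ) : ℂ) by push_cast; rfl,
      Complex.re_ofReal_mul]
  rw [hre]
  have h4 : ‖s‖ ≤ |s.re| + 1 := (Complex.norm_le_abs_re_add_abs_im s).trans (by
    have : |s.im| ≤ 1 := h3
    linarith)
  have h5 : ‖s‖ ^ n = ‖s‖ ^ (n + (1 + α / 2 + 1)) * ‖s‖ ^ (-1 - α / 2 - 1) := by
    rw [← Real.rpow_add hn, ← Real.rpow_natCast]; congr 1; ring
  have h6 : Real.exp ((Real.pi / 2 - |b|) * ‖s‖) * Real.exp ((b - Real.pi / 2) * s.re) ≤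
      Real.exp (Real.pi / 2 - |b|) * Real.exp (Real.pi * (|s.re| - s.re) / 2) := by
    rw [← Real.exp_add, ← Real.exp_add]
    refine Real.exp_le_exp.mpr ?_
    have h7 := mul_le_mul_of_nonneg_left h4 (sub_pos.mpr hb).le
    have h8 : b * s.re ≤ |b| * |s.re| := by rw [← abs_mul]; exact le_abs_self _
    nlinarith
  calc ‖s‖ ^ n * Real.exp ((b - Real.pi / 2) * s.re)
      = ‖s‖ ^ (n + (1 + α / 2 + 1)) * ‖s‖ ^ (-1 - α / 2 - 1) *
          Real.exp ((b - Real.pi / 2) * s.re) := by rw [← h5]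
    _ ≤ K * Real.exp ((Real.pi / 2 - |b|) * ‖s‖) * ‖s‖ ^ (-1 - α / 2 - 1) *
          Real.exp ((b - Real.pi / 2) * s.re) := by gcongr
    _ = K * ‖s‖ ^ (-1 - α / 2 - 1) * (Real.exp ((Real.pi / 2 - |b|) * ‖s‖) *
          Real.exp ((b - Real.pi / 2) * s.re)) := by ring
    _ ≤ K * ‖s‖ ^ (-1 - α / 2 - 1) * (Real.exp (Real.pi / 2 - |b|) *
          Real.exp (Real.pi * (|s.re| - s.re) / 2)) := by gcongr
    _ = _ := by ring

/-! ### Ladder operators and eigenfunctions. -/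

/-- The raising operator. -/
def raise (α : ℝ) (f : ℂ → ℂ) (s : ℂ) : ℂ :=
  2 * mulVar f s - (shiftDown α f s + shiftUp α f s)

/-- The lowering operator. -/
def lower (α : ℝ) (f : ℂ → ℂ) (s : ℂ) : ℂ :=
  2 * mulVar f s + (shiftDown α f s + shiftUp α f s)

/-- The unnormalised eigenfunctions of `diffOp α 0`: Meixner–Pollaczek polynomials times
`exp (-π s / 2)`. -/
def eigenfun (α : ℝ) : ℕ → ℂ → ℂ
  | 0 => fun s => Complex.exp (-(Real.pi / 2) * s)
  | n + 1 => raise α (eigenfun α n)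

theorem raise_add_lower (α : ℝ) (f : ℂ → ℂ) (s : ℂ) :
    raise α f s + lower α f s = 4 * mulVar f s := by
  simp only [raise, lower]; ring

theorem raise_smul (α : ℝ) (a : ℂ) (f : ℂ → ℂ) : raise α (a • f) = a • raise α f := by
  ext s; simp only [raise, mulVar, shiftDown, shiftUp, Pi.smul_apply, smul_eq_mul]; ring

/-- The commutator [`diffOp α 0`, `raise`] = -2 `raise`; with [`lower`, `raise`] = -4 `diffOp α 0`
below, these are the sl(2) relations that drive the ladder. -/
theorem diffOp_raise (α : ℝ) (f : ℂ → ℂ) :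
    diffOp α 0 (raise α f) = raise α (diffOp α 0 f) - (2 : ℂ) • raise α f := by
  ext s
  have h1 : s - Complex.I + Complex.I = s := by ring
  have h2 : s + Complex.I - Complex.I = s := by ring
  simp only [diffOp, raise, mulVar, shiftDown, shiftUp, Pi.sub_apply, Pi.smul_apply, smul_eq_mul,
    h1, h2]
  push_cast
  ring_nf
  simp only [Complex.I_sq, Complex.I_pow_three, Complex.I_pow_four]
  ring

theorem lower_raise (α : ℝ) (f : ℂ → ℂ) :
    lower α (raise α f) = raise α (lower α f) - (4 : ℂ) • diffOp α 0 f := by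
  ext s
  have h1 : s - Complex.I + Complex.I = s := by ring
  have h2 : s + Complex.I - Complex.I = s := by ring
  simp only [diffOp, raise, lower, mulVar, shiftDown, shiftUp, Pi.sub_apply, Pi.smul_apply,
    smul_eq_mul, h1, h2]
  push_cast
  ring

theorem exp_shift_sub (s : ℂ) : Complex.exp (-(Real.pi / 2) * (s - Complex.I)) =
    Complex.I * Complex.exp (-(Real.pi / 2) * s) := by
  rw [show -(Real.pi / 2 : ℂ) * (s - Complex.I) =
    Real.pi / 2 * Complex.I + -(Real.pi / 2) * s by ring, Complex.exp_add,
    Complex.exp_pi_div_two_mul_I]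

theorem exp_shift_add (s : ℂ) : Complex.exp (-(Real.pi / 2) * (s + Complex.I)) =
    -Complex.I * Complex.exp (-(Real.pi / 2) * s) := by
  rw [show -(Real.pi / 2 : ℂ) * (s + Complex.I) =
    -Real.pi / 2 * Complex.I + -(Real.pi / 2) * s by ring, Complex.exp_add,
    Complex.exp_neg_pi_div_two_mul_I]

/-- The shifts s ∓ i multiply exp(-πs/2) by ±i, which gives the eigenvalue -α at the bottom; each
`raise` then subtracts 2. -/
theorem diffOp_eigenfun (α : ℝ) (n : ℕ) :
    diffOp α 0 (eigenfun α n) = (-(α + 2 * n) : ℂ) • eigenfun α n := by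
  induction n with
  | zero =>
    ext s
    simp only [diffOp, eigenfun, mulVar, shiftDown, shiftUp, exp_shift_sub, exp_shift_add,
      Pi.smul_apply, smul_eq_mul]
    push_cast
    ring_nf
    simp only [Complex.I_sq]
    ring
  | succ n ih =>
    rw [eigenfun, diffOp_raise, ih, raise_smul, ← sub_smul]
    congr 1; push_cast; ring

theorem lower_eigenfun_zero (α : ℝ) : lower α (eigenfun α 0) = 0 := by
  ext s
  simp only [lower, eigenfun, mulVar, shiftDown, shiftUp, exp_shift_sub, exp_shift_add,
    Pi.zero_apply]
  ring_nf
  simp only [Complex.I_sq]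
  ring

/-- The coefficients of the lowering operator: it maps `eigenfun α (n + 1)` to
`ladderCoeff α n • eigenfun α n`. -/
def ladderCoeff (α : ℝ) (n : ℕ) : ℝ := 4 * (n + 1) * (α + n)

theorem ladderCoeff_pos {α : ℝ} (hα : 0 < α) (n : ℕ) : 0 < ladderCoeff α n := by
  unfold ladderCoeff; positivity

/-- Commuting `lower` past `raise` adds 4(α + 2n) at level n, and `ladderCoeff` is the resulting
sum. -/
theorem lower_eigenfun_succ (α : ℝ) (n : ℕ) :
    lower α (eigenfun α (n + 1)) = (ladderCoeff α n : ℂ) • eigenfun α n := by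
  induction n with
  | zero =>
    rw [show eigenfun α (0 + 1) = raise α (eigenfun α 0) from rfl, lower_raise,
      lower_eigenfun_zero, diffOp_eigenfun]
    ext s
    simp [raise, mulVar, shiftDown, shiftUp, ladderCoeff]
    ring
  | succ n ih =>
    rw [eigenfun, lower_raise, ih, diffOp_eigenfun, raise_smul, ← eigenfun, smul_smul, ← sub_smul]
    congr 1; simp only [ladderCoeff]; push_cast; ring

theorem mulVar_eigenfun_zero (α : ℝ) :
    mulVar (eigenfun α 0) = (1 / 4 : ℂ) • eigenfun α 1 := by
  ext s
  have h := raise_add_lower α (eigenfun α 0) s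
  rw [lower_eigenfun_zero, ← eigenfun] at h
  simp only [Pi.zero_apply, add_zero] at h
  simp only [Pi.smul_apply, smul_eq_mul, h]; ring

theorem mulVar_eigenfun_succ (α : ℝ) (n : ℕ) :
    mulVar (eigenfun α (n + 1)) =
      (1 / 4 : ℂ) • (eigenfun α (n + 2) + (ladderCoeff α n : ℂ) • eigenfun α n) := by
  ext s
  have h := raise_add_lower α (eigenfun α (n + 1)) s
  rw [lower_eigenfun_succ, ← eigenfun] at h
  simp only [Pi.smul_apply, Pi.add_apply] at h ⊢
  rw [h, smul_eq_mul]; ring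

theorem exists_polynomial_eigenfun (α : ℝ) (n : ℕ) : ∃ p : Polynomial ℂ, ∀ s : ℂ,
    eigenfun α n s = p.eval s * Complex.exp (-(Real.pi / 2) * s) := by
  induction n with
  | zero => exact ⟨1, fun s => by simp [eigenfun]⟩
  | succ n ih =>
    obtain ⟨p, hp⟩ := ih
    refine ⟨2 * Polynomial.X * p -
      ((Polynomial.C (α / 2 : ℂ) + Polynomial.C Complex.I * Polynomial.X) *
        Polynomial.C Complex.I * p.comp (Polynomial.X - Polynomial.C Complex.I) -
      (Polynomial.C (α / 2 : ℂ) - Polynomial.C Complex.I * Polynomial.X) *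
        Polynomial.C Complex.I * p.comp (Polynomial.X + Polynomial.C Complex.I)), fun s => ?_⟩
    simp only [eigenfun, raise, mulVar, shiftDown, shiftUp, hp, exp_shift_sub, exp_shift_add,
      Polynomial.eval_sub, Polynomial.eval_mul, Polynomial.eval_add, Polynomial.eval_C,
      Polynomial.eval_X, Polynomial.eval_comp, Polynomial.eval_ofNat]
    ring

theorem eigenfun_mem_H (α : ℝ) (n : ℕ) : eigenfun α n ∈ H α := by
  obtain ⟨p, hp⟩ := exists_polynomial_eigenfun α n
  have : eigenfun α n = ∑ i ∈ Finset.range (p.natDegree + 1), p.coeff i •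
      fun s : ℂ => s ^ i * Complex.exp (((0 : ℝ) - Real.pi / 2) * s) := by
    ext s
    simp only [hp, Polynomial.eval_eq_sum_range, Finset.sum_mul, Finset.sum_apply, Pi.smul_apply,
      smul_eq_mul, Complex.ofReal_zero, zero_sub]
    exact Finset.sum_congr rfl fun i _ => by ring
  rw [this]
  exact Submodule.sum_mem _ fun i _ => Submodule.smul_mem _ _
    (pow_mul_exp_mem_H i (by simpa using Real.pi_pos))

/-! ### Orthogonality and norms of the eigenvectors. -/

/-- The class of `eigenfun α n` in `L²(ℝ, w(t) dt)`. -/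
def eigenvec {α : ℝ} (hα : 0 < α) (n : ℕ) : L2w α := toL2 hα ⟨_, eigenfun_mem_H α n⟩

theorem inner_eigenvec {α : ℝ} (hα : 0 < α) (m n : ℕ) :
    inner ℂ (eigenvec hα m) (eigenvec hα n) =
      ∫ t : ℝ, (starRingEnd ℂ) (eigenfun α m t) * eigenfun α n t ∂weightMeasure α :=
  inner_eq_integral (coeFn_toL2 hα _) (coeFn_toL2 hα _)

/-- Eigenvectors of the symmetric `diffOp α 0` for distinct real eigenvalues. -/
theorem inner_eigenvec_of_ne {α : ℝ} (hα : 0 < α) {m n : ℕ} (hmn : m ≠ n) :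
    inner ℂ (eigenvec hα m) (eigenvec hα n) = 0 := by
  have h := integral_diffOp hα 0 (eigenfun_mem_H α n) (eigenfun_mem_H α m)
  simp only [diffOp_eigenfun, Pi.smul_apply, smul_eq_mul, map_mul, mul_left_comm _ (-_ : ℂ),
    mul_assoc, integral_const_mul, ← inner_eigenvec hα] at h
  simp only [map_neg, map_add, map_mul, Complex.conj_ofReal, map_ofNat, map_natCast] at h
  have h2 : (2 * ((n : ℂ) - m)) * inner ℂ (eigenvec hα m) (eigenvec hα n) = 0 := by
    linear_combination -h
  refine (mul_eq_zero.mp h2).resolve_left ?_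
  simpa [sub_eq_zero] using hmn.symm

/-- Evaluate the pairing of e_{n+1} with t·e_n twice, letting t act on either side through the
three-term recurrence; orthogonality leaves one norm on each side. -/
theorem norm_sq_eigenvec_succ {α : ℝ} (hα : 0 < α) (n : ℕ) :
    ‖eigenvec hα (n + 1)‖ ^ 2 = ladderCoeff α n * ‖eigenvec hα n‖ ^ 2 := by
  have key : inner ℂ (eigenvec hα (n + 1)) (eigenvec hα (n + 1)) =
      (ladderCoeff α n : ℂ) * inner ℂ (eigenvec hα n) (eigenvec hα n) := by
    have mem := fun k => memLp_of_mem_H hα (eigenfun_mem_H α k)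
    have e : ∫ t : ℝ, (starRingEnd ℂ) (eigenfun α (n + 1) t) * mulVar (eigenfun α n) t
          ∂weightMeasure α =
        ∫ t : ℝ, (starRingEnd ℂ) (mulVar (eigenfun α (n + 1)) t) * eigenfun α n t
          ∂weightMeasure α := by
      congr 1; ext t; simp only [mulVar, map_mul, Complex.conj_ofReal]; ring
    have hr : ∫ t : ℝ, (starRingEnd ℂ) (mulVar (eigenfun α (n + 1)) t) * eigenfun α n t
          ∂weightMeasure α =
        1 / 4 * (inner ℂ (eigenvec hα (n + 2)) (eigenvec hα n) +
          (ladderCoeff α n : ℂ) * inner ℂ (eigenvec hα n) (eigenvec hα n)) := by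
      rw [inner_eigenvec, inner_eigenvec, ← integral_const_mul, ← integral_add
        (integrable_conj_mul (mem n) (mem (n + 2)))
        ((integrable_conj_mul (mem n) (mem n)).const_mul _), ← integral_const_mul]
      congr 1; ext t
      simp only [mulVar_eigenfun_succ, Pi.smul_apply, Pi.add_apply, smul_eq_mul, map_mul, map_add,
        Complex.conj_ofReal, map_div₀, map_one, map_ofNat]
      ring
    have hl : ∫ t : ℝ, (starRingEnd ℂ) (eigenfun α (n + 1) t) * mulVar (eigenfun α n) t
          ∂weightMeasure α = 1 / 4 * inner ℂ (eigenvec hα (n + 1)) (eigenvec hα (n + 1)) := by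
      cases n with
      | zero =>
        rw [inner_eigenvec, ← integral_const_mul]
        congr 1; ext t
        simp only [mulVar_eigenfun_zero, Pi.smul_apply, smul_eq_mul, zero_add]
        ring
      | succ n =>
        have h0 := inner_eigenvec_of_ne hα (m := n + 2) (n := n) (by omega)
        have : ∫ t : ℝ, (starRingEnd ℂ) (eigenfun α (n + 1 + 1) t) * mulVar (eigenfun α (n + 1)) t
            ∂weightMeasure α =
            1 / 4 * (inner ℂ (eigenvec hα (n + 1 + 1)) (eigenvec hα (n + 1 + 1)) +
              (ladderCoeff α n : ℂ) * inner ℂ (eigenvec hα (n + 2)) (eigenvec hα n)) := by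
          rw [inner_eigenvec, inner_eigenvec, ← integral_const_mul, ← integral_add
            (integrable_conj_mul (mem (n + 2)) (mem (n + 2)))
            ((integrable_conj_mul (mem n) (mem (n + 2))).const_mul _), ← integral_const_mul]
          congr 1; ext t
          simp only [mulVar_eigenfun_succ, Pi.smul_apply, Pi.add_apply, smul_eq_mul]
          ring
        rw [this, h0]; ring
    rw [hl, hr, inner_eigenvec_of_ne hα (m := n + 2) (n := n) (by omega)] at e
    linear_combination 4 * e
  rw [inner_self_eq_norm_sq_to_K, inner_self_eq_norm_sq_to_K] at key
  apply Complex.ofReal_injective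
  push_cast
  simpa using key

theorem eigenvec_ne_zero {α : ℝ} (hα : 0 < α) (n : ℕ) : eigenvec hα n ≠ 0 := by
  induction n with
  | zero =>
    intro h
    have h1 := coeFn_toL2 hα ⟨_, eigenfun_mem_H α 0⟩
    rw [← eigenvec, h] at h1
    have := eq_zero_of_ae hα (eigenfun_mem_H α 0) (h1.symm.trans (Lp.coeFn_zero _ _ _)) (s := 0)
      (by simp)
    simp [eigenfun] at this
  | succ n ih =>
    rw [← norm_pos_iff] at ih ⊢
    have h := norm_sq_eigenvec_succ hα n
    have := ladderCoeff_pos hα n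
    have : 0 < ‖eigenvec hα (n + 1)‖ ^ 2 := by rw [h]; positivity
    exact lt_of_le_of_ne (norm_nonneg _) fun h0 => by simp [← h0] at this

end Vilenkin

/-! ### Jacobi recurrences with linear growth. -/

/-- Carleman's criterion for a Jacobi matrix with linearly growing entries, in an orthogonal but
not normalised basis: a square-summable solution of the eigenvalue recurrence with non-real
spectral parameter vanishes. -/
theorem eq_zero_of_jacobi_recurrence {α c : ℝ} (hα : 0 < α) {ζ : ℂ} (hζ : ζ.im ≠ 0)
    {u : ℕ → ℂ} {ρ : ℕ → ℝ} (hρ : ∀ n, 0 < ρ n)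
    (hρ' : ∀ n, ρ n = 4 * (n + 1) * (α + n) * ρ (n + 1))
    (h0 : (ζ + α) * u 0 = c / 4 * u 1)
    (h1 : ∀ n : ℕ, (ζ + (α + 2 * (n + 1))) * u (n + 1) =
      c / 4 * (u (n + 2) + 4 * (n + 1) * (α + n) * u n))
    {M : ℝ} (hM : ∀ N : ℕ, ∑ n ∈ Finset.range N, ρ n * ‖u n‖ ^ 2 ≤ M) (m : ℕ) : u m = 0 := by
  have him : ∀ z w : ℂ, (z * (starRingEnd ℂ) w).im = -(w * (starRingEnd ℂ) z).im := by
    intro z w; simp; ring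
  have hself : ∀ z : ℂ, z * (starRingEnd ℂ) z = ((‖z‖ ^ 2 : ℝ) : ℂ) := by
    intro z; rw [Complex.mul_conj, Complex.normSq_eq_norm_sq]
  -- Green's identity: multiply the recurrence by ρ and conj u and take imaginary parts. The real
  -- diagonal drops out and the off-diagonal terms telescope, leaving one boundary term.
  have hwr : ∀ n, ζ.im * ∑ k ∈ Finset.range (n + 1), ρ k * ‖u k‖ ^ 2 =
      c / 4 * ρ n * (u (n + 1) * (starRingEnd ℂ) (u n)).im := by
    intro n
    induction n with
    | zero =>
      have e := congrArg (fun z => (z * (starRingEnd ℂ) (u 0)).im) h0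
      simp only [mul_assoc, hself] at e
      rw [Complex.im_mul_ofReal, show (c / 4 : ℂ) = ((c / 4 : ℝ) : ℂ) by push_cast; rfl,
        Complex.im_ofReal_mul] at e
      simp only [Complex.add_im, Complex.ofReal_im, add_zero] at e
      simp only [zero_add, Finset.range_one, Finset.sum_singleton]
      linear_combination ρ 0 * e
    | succ n ih =>
      have e := congrArg (fun z => (z * (starRingEnd ℂ) (u (n + 1))).im) (h1 n)
      simp only [mul_assoc, hself, add_mul (u (n + 2))] at e
      rw [Complex.im_mul_ofReal, show (c / 4 : ℂ) = ((c / 4 : ℝ) : ℂ) by push_cast; rfl,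
        Complex.im_ofReal_mul, Complex.add_im (u (n + 2) * _),
        show (4 * ((n + 1) * ((α + n) * (u n * (starRingEnd ℂ) (u (n + 1))))) : ℂ) =
          ((4 * (n + 1) * (α + n) : ℝ) : ℂ) * (u n * (starRingEnd ℂ) (u (n + 1))) by
          push_cast; ring, Complex.im_ofReal_mul, him (u n)] at e
      have e2 : (ζ + (α + 2 * (n + 1)) : ℂ).im = ζ.im := by simp
      rw [e2] at e
      rw [Finset.sum_range_succ, mul_add, ih, hρ' n]
      linear_combination ρ (n + 1) * e
  set v : ℕ → ℝ := fun n => ρ n * ‖u n‖ ^ 2 with hv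
  have hv0 : ∀ n, 0 ≤ v n := fun n => mul_nonneg (hρ n).le (sq_nonneg _)
  have hsum : Summable v := summable_of_sum_range_le hv0 hM
  have hbound : ∀ n : ℕ, |ζ.im| * ∑ k ∈ Finset.range (n + 1), v k ≤
      |c| / 4 * ((n + 1 + α) * (v n + v (n + 1))) := by
    intro n
    have e := congrArg abs (hwr n)
    rw [abs_mul, abs_of_nonneg (Finset.sum_nonneg fun k _ => hv0 k)] at e
    rw [e, mul_assoc, abs_mul, abs_div, abs_of_pos (show (0 : ℝ) < 4 by norm_num)]
    refine mul_le_mul_of_nonneg_left ?_ (by positivity)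
    have e1 : |(u (n + 1) * (starRingEnd ℂ) (u n)).im| ≤ ‖u (n + 1)‖ * ‖u n‖ := by
      refine (Complex.abs_im_le_norm _).trans ?_
      simp
    rw [abs_mul, abs_of_pos (hρ n)]
    set s : ℝ := n + 1 + α with hs
    have hn : (0 : ℝ) ≤ n := n.cast_nonneg
    have hs0 : 0 < s := by positivity
    -- The ratio ρ n / ρ (n+1) is at most (2s)², so the arithmetic–geometric mean inequality bounds
    -- the boundary term by s (v n + v (n+1)).
    have e2 : 4 * (n + 1) * (α + n) ≤ (2 * s) ^ 2 := by rw [hs]; nlinarith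
    have e3 : ρ n * (‖u (n + 1)‖ * ‖u n‖) * (2 * s) ≤ s * (v n + v (n + 1)) * (2 * s) := by
      have e4 : ρ n * ‖u (n + 1)‖ ^ 2 ≤ (2 * s) ^ 2 * v (n + 1) := by
        calc ρ n * ‖u (n + 1)‖ ^ 2 = 4 * (n + 1) * (α + n) * v (n + 1) := by
              rw [hρ' n]; simp only [hv]; ring
          _ ≤ _ := mul_le_mul_of_nonneg_right e2 (hv0 _)
      have e5 : 0 ≤ ρ n * (‖u (n + 1)‖ - 2 * s * ‖u n‖) ^ 2 :=
        mul_nonneg (hρ n).le (sq_nonneg _)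
      have e6 : v n = ρ n * ‖u n‖ ^ 2 := rfl
      nlinarith
    exact (mul_le_mul_of_nonneg_left e1 (hρ n).le).trans (le_of_mul_le_mul_right e3 (by positivity))
  by_contra hm
  have hvm : 0 < v m := mul_pos (hρ m) (pow_pos (norm_pos_iff.mpr hm) 2)
  have hζ' : 0 < |ζ.im| := abs_pos.mpr hζ
  have hs2 : Summable fun n => (|c| / 4 * (1 + α) / (|ζ.im| * v m)) * (v n + v (n + 1)) :=
    (hsum.add ((summable_nat_add_iff 1).mpr hsum)).mul_left _
  -- If u m ≠ 0, the left side of `hbound` is at least |Im ζ| v m for n ≥ m, so 1/(n+1) is at most a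
  -- constant times a summable sequence, contradicting divergence of the harmonic series.
  refine (mt (summable_nat_add_iff 1).mp Real.not_summable_one_div_natCast) ?_
  refine Summable.of_norm_bounded_eventually_nat hs2 ?_
  filter_upwards [eventually_ge_atTop m] with n hn
  have e1 : v m ≤ ∑ k ∈ Finset.range (n + 1), v k :=
    Finset.single_le_sum (fun k _ => hv0 k) (Finset.mem_range.mpr (by omega))
  have e2 := (mul_le_mul_of_nonneg_left e1 hζ'.le).trans (hbound n)
  have hn0 : (0 : ℝ) ≤ n := n.cast_nonneg
  have e3 : (n + 1 + α : ℝ) ≤ (1 + α) * (n + 1) := by nlinarith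
  rw [Real.norm_of_nonneg (by positivity), div_mul_eq_mul_div, Nat.cast_add, Nat.cast_one,
    div_le_div_iff₀ (by positivity) (by positivity), one_mul]
  have hvv : 0 ≤ v n + v (n + 1) := add_nonneg (hv0 _) (hv0 _)
  calc |ζ.im| * v m ≤ _ := e2
    _ ≤ |c| / 4 * (((1 + α) * (n + 1)) * (v n + v (n + 1))) := by gcongr
    _ = _ := by ring

/-! ### Uniqueness from Fourier transforms and moments. -/

open FourierTransform in
/-- An integrable function whose Fourier transform vanishes is zero almost everywhere. -/
theorem ae_eq_zero_of_fourier_eq_zero {v : ℝ → ℂ} (hv : Integrable v)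
    (h : ∀ w : ℝ, 𝓕 v w = 0) : v =ᵐ[volume] 0 := by
  refine ae_eq_zero_of_integral_contDiff_smul_eq_zero hv.locallyIntegrable fun g hg hc => ?_
  have hc' : HasCompactSupport (Complex.ofRealCLM ∘ g) := hc.comp_left rfl
  have hg' : ContDiff ℝ (⊤ : ℕ∞) (Complex.ofRealCLM ∘ g) := by fun_prop
  let G : SchwartzMap ℝ ℂ := hc'.toSchwartzMap hg'
  have flip : ∀ Φ : SchwartzMap ℝ ℂ, ∫ x, (𝓕 Φ) x • v x = ∫ x, Φ x • 𝓕 v x := fun Φ => by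
    simpa using! VectorFourier.integral_fourierIntegral_smul_eq_flip (μ := volume) (ν := volume)
      (L := innerₗ ℝ) Real.continuous_fourierChar continuous_inner Φ.integrable hv
  -- The test function is the transform of `𝓕⁻ G`, so its pairing with v moves onto the vanishing
  -- transform of v.
  have key := flip (𝓕⁻ G)
  rw [FourierTransform.fourier_fourierInv_eq] at key
  simp only [h, smul_zero, integral_zero] at key
  exact key

/-- A function with exponential decay is determined by its moments. -/
theorem ae_eq_zero_of_integral_pow_mul_eq_zero {v : ℝ → ℂ} (hm : AEStronglyMeasurable v volume)
    (hv : Integrable fun t => Real.exp |t| * ‖v t‖)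
    (h : ∀ k : ℕ, ∫ t : ℝ, (t : ℂ) ^ k * v t = 0) : v =ᵐ[volume] 0 := by
  have hpow : ∀ k : ℕ, Integrable fun t => |t| ^ k * Real.exp (|t| / 2) * ‖v t‖ := by
    intro k
    refine (hv.const_mul (2 ^ k * k.factorial)).mono' (by fun_prop)
      (Eventually.of_forall fun t => ?_)
    have e := Real.pow_div_factorial_le_exp (x := |t| / 2) (by positivity) k
    rw [div_le_iff₀ (by positivity), div_pow, div_le_iff₀ (by positivity)] at e
    rw [Real.norm_of_nonneg (by positivity)]
    calc |t| ^ k * Real.exp (|t| / 2) * ‖v t‖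
        ≤ (Real.exp (|t| / 2) * k.factorial * 2 ^ k) * Real.exp (|t| / 2) * ‖v t‖ := by gcongr
      _ = 2 ^ k * k.factorial * ((Real.exp (|t| / 2) * Real.exp (|t| / 2)) * ‖v t‖) := by ring
      _ = _ := by rw [← Real.exp_add, add_halves]
  -- Analytic continuation of the Fourier transform along the real axis in steps of length at most
  -- 1/2: all derivatives vanish at a', hence the Taylor series vanishes at a = a' + d. Steps of 1/2
  -- use exp(|t|/2), and the other half of exp |t| absorbs the powers of t.
  have hstep : ∀ (n : ℕ) (a : ℝ), |a| ≤ n / 2 → ∀ k : ℕ,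
      ∫ t : ℝ, (t : ℂ) ^ k * (Complex.exp (a * t * Complex.I) * v t) = 0 := by
    intro n
    induction n with
    | zero =>
      intro a ha k
      have : a = 0 := by simpa using ha
      simpa [this] using h k
    | succ n ih =>
      intro a ha k
      have hn : (0 : ℝ) < n + 1 := by positivity
      push_cast at ha
      set a' := a * (n / (n + 1)) with ha'
      set d := a / (n + 1) with hd
      have had : a = a' + d := by rw [ha', hd]; field_simp
      have h1 : |a'| ≤ n / 2 := by
        rw [ha', abs_mul, abs_of_nonneg (by positivity : (0 : ℝ) ≤ n / (n + 1))]
        calc |a| * (n / (n + 1)) ≤ (n + 1) / 2 * (n / (n + 1)) := by gcongr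
          _ = n / 2 := by field_simp
      have h2 : |d| ≤ 1 / 2 := by
        rw [hd, abs_div, abs_of_pos hn, div_le_iff₀ hn]; linarith
      have hs := hasSum_integral_of_dominated_convergence (μ := volume)
        (F := fun (j : ℕ) (t : ℝ) => (d * Complex.I) ^ j / j.factorial *
          ((t : ℂ) ^ (k + j) * (Complex.exp (a' * t * Complex.I) * v t)))
        (f := fun t : ℝ => (t : ℂ) ^ k * (Complex.exp (a * t * Complex.I) * v t))
        (fun j t => |t| ^ k * ((|t| / 2) ^ j / j.factorial) * ‖v t‖) ?_ ?_ ?_ ?_ ?_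
      · simp only [integral_const_mul, ih a' h1, mul_zero] at hs
        exact hs.unique hasSum_zero
      · intro j; fun_prop
      · refine fun j => Eventually.of_forall fun t => ?_
        have e1 : ‖Complex.exp (a' * t * Complex.I)‖ = 1 := by
          rw [← Complex.ofReal_mul, Complex.norm_exp_ofReal_mul_I]
        rw [norm_mul, norm_mul, norm_mul, norm_div, norm_pow, norm_pow, norm_mul, e1,
          Complex.norm_I, Complex.norm_real, Complex.norm_real, Complex.norm_natCast, one_mul,
          mul_one, Real.norm_eq_abs, Real.norm_eq_abs]
        calc |d| ^ j / j.factorial * (|t| ^ (k + j) * ‖v t‖)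
            ≤ (1 / 2) ^ j / j.factorial * (|t| ^ (k + j) * ‖v t‖) := by gcongr
          _ = _ := by rw [div_pow, div_pow, pow_add]; ring
      · refine Eventually.of_forall fun t => ?_
        exact ((Real.summable_pow_div_factorial (|t| / 2)).mul_left _).mul_right _
      · refine (hpow k).congr (Eventually.of_forall fun t => ?_)
        simp only
        rw [tsum_mul_right, tsum_mul_left, Real.exp_eq_exp_ℝ, NormedSpace.exp_eq_tsum_div]
      · refine Eventually.of_forall fun t => ?_
        have e := NormedSpace.expSeries_div_hasSum_exp (𝔸 := ℂ) (d * t * Complex.I)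
        rw [← Complex.exp_eq_exp_ℂ] at e
        have hval : (t : ℂ) ^ k * (Complex.exp (a * t * Complex.I) * v t) =
            (t : ℂ) ^ k * (Complex.exp (a' * t * Complex.I) * v t) *
              Complex.exp (d * t * Complex.I) := by
          rw [had, show (((a' + d : ℝ) : ℂ) * t * Complex.I) =
            a' * t * Complex.I + d * t * Complex.I by push_cast; ring, Complex.exp_add]
          ring
        have hterm : ∀ j : ℕ, (t : ℂ) ^ k * (Complex.exp (a' * t * Complex.I) * v t) *
            ((d * t * Complex.I) ^ j / j.factorial) = (d * Complex.I) ^ j / j.factorial *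
              ((t : ℂ) ^ (k + j) * (Complex.exp (a' * t * Complex.I) * v t)) := by
          intro j; rw [mul_pow, mul_pow, mul_pow, pow_add]; ring
        have e2 := e.mul_left ((t : ℂ) ^ k * (Complex.exp (a' * t * Complex.I) * v t))
        simp only [hterm] at e2
        rw [hval]
        exact e2
  have hi : Integrable v := by
    refine hv.mono' hm (Eventually.of_forall fun t => ?_)
    have : 1 ≤ Real.exp |t| := Real.one_le_exp (abs_nonneg t)
    nlinarith [norm_nonneg (v t)]
  refine ae_eq_zero_of_fourier_eq_zero hi fun w => ?_
  obtain ⟨n, hn⟩ := exists_nat_ge (2 * |-2 * Real.pi * w|)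
  have e := hstep n (-2 * Real.pi * w) (by linarith) 0
  rw [Real.fourier_real_eq_integral_exp_smul, ← e]
  congr 1; ext t
  simp only [pow_zero, one_mul, smul_eq_mul]
  congr 3; push_cast; ring

/-! ### Completeness of the eigenvectors. -/

namespace Vilenkin

theorem exp_mem_H {α : ℝ} {b : ℝ} (hb : |b| < Real.pi / 2) :
    (fun s : ℂ => Complex.exp ((b - Real.pi / 2) * s)) ∈ H α := by
  simpa using pow_mul_exp_mem_H (α := α) 0 hb

/-- The functions `eigenfun α n` span a dense subspace. -/
theorem eq_zero_of_inner_eigenvec {α : ℝ} (hα : 0 < α) {u : L2w α}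
    (hu : ∀ n, inner ℂ (eigenvec hα n) u = 0) : u = 0 := by
  set S : Submodule ℂ (ℂ → ℂ) := Submodule.span ℂ (Set.range (eigenfun α)) with hS
  have hSH : S ≤ H α := Submodule.span_le.mpr (by rintro _ ⟨n, rfl⟩; exact eigenfun_mem_H α n)
  -- The three-term recurrence makes the span stable under multiplication by s. Starting from
  -- exp(-πs/2) it contains every s^k exp(-πs/2), so orthogonality to the eigenvectors makes all
  -- moments of w(t) exp(-πt/2) u(t) vanish.
  have hmul : ∀ f ∈ S, mulVar f ∈ S := by
    intro f hf
    refine Submodule.span_induction (p := fun f _ => mulVar f ∈ S) ?_ ?_ ?_ ?_ hf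
    · rintro _ ⟨n, rfl⟩
      have mem : ∀ k, eigenfun α k ∈ S := fun k => Submodule.subset_span ⟨k, rfl⟩
      cases n with
      | zero => rw [mulVar_eigenfun_zero]; exact S.smul_mem _ (mem _)
      | succ n =>
        rw [mulVar_eigenfun_succ]
        exact S.smul_mem _ (S.add_mem (mem _) (S.smul_mem _ (mem _)))
    · convert S.zero_mem using 1
      ext s; simp [mulVar]
    · intro f g _ _ hf hg
      convert S.add_mem hf hg using 1
      ext s; simp [mulVar, mul_add]
    · intro c f _ hf
      convert S.smul_mem c hf using 1
      ext s; simp [mulVar, mul_left_comm]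
  have hzero : ∀ f ∈ S, ∫ t : ℝ, (starRingEnd ℂ) (f t) * u t ∂weightMeasure α = 0 := by
    intro f hf
    have h : ∀ f (hf : f ∈ S), inner ℂ (toL2 hα ⟨f, hSH hf⟩) u = 0 := by
      intro f hf
      refine Submodule.span_induction
        (p := fun f hf => inner ℂ (toL2 hα ⟨f, hSH hf⟩) u = 0) ?_ ?_ ?_ ?_ hf
      · rintro _ ⟨n, rfl⟩
        exact hu n
      · exact (congrArg (fun x => inner ℂ x u) (map_zero (toL2 hα))).trans (inner_zero_left _)
      · intro f g hf hg h1 h2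
        have := map_add (toL2 hα) ⟨f, hSH hf⟩ ⟨g, hSH hg⟩
        refine (congrArg (fun x => inner ℂ x u) this).trans ?_
        rw [inner_add_left, h1, h2, add_zero]
      · intro c f hf h1
        have := map_smul (toL2 hα) c ⟨f, hSH hf⟩
        refine (congrArg (fun x => inner ℂ x u) this).trans ?_
        rw [inner_smul_left, h1, mul_zero]
    rw [← h f hf]
    exact (inner_eq_integral (coeFn_toL2 hα ⟨f, hSH hf⟩) (EventuallyEq.refl _ _)).symm
  have hpow : ∀ k : ℕ, (fun s : ℂ => s ^ k * Complex.exp (-(Real.pi / 2) * s)) ∈ S := by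
    intro k
    induction k with
    | zero =>
      have : eigenfun α 0 ∈ S := Submodule.subset_span ⟨0, rfl⟩
      simpa [eigenfun] using this
    | succ k ih =>
      convert hmul _ ih using 1
      ext s; simp only [mulVar]; ring
  have hac := volume_absolutelyContinuous hα
  -- Integrability comes from pairing u with the square-integrable exponentials of `exp_mem_H`;
  -- below, b = ±1 is allowed because 1 < π/2.
  have hexp : ∀ b : ℝ, |b| < Real.pi / 2 → Integrable fun t : ℝ =>
      Real.exp (b * t) * ‖weight α t • (Complex.exp (-(Real.pi / 2) * t) * u t)‖ := by
    intro b hb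
    have h := ((integrable_weightMeasure_iff hα).mp
      (integrable_conj_mul (Lp.memLp u) (memLp_of_mem_H hα (exp_mem_H hb)))).norm
    refine h.congr (Eventually.of_forall fun t => ?_)
    simp only [norm_smul, norm_mul, RCLike.norm_conj, Complex.norm_exp]
    have e1 : (((b : ℂ) - Real.pi / 2) * t).re = b * t + -(Real.pi / 2) * t := by simp; ring
    have e2 : (-(Real.pi / 2 : ℂ) * t).re = -(Real.pi / 2) * t := by simp
    rw [e1, e2, Real.exp_add]
    ring
  have hum : AEStronglyMeasurable u (volume : Measure ℝ) :=
    (Lp.aestronglyMeasurable u).mono_ac hac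
  have hvm : AEStronglyMeasurable
      (fun t : ℝ => weight α t • (Complex.exp (-(Real.pi / 2) * t) * u t)) volume :=
    (measurable_weight hα).aestronglyMeasurable.smul
      ((by fun_prop : Continuous fun t : ℝ =>
        Complex.exp (-(Real.pi / 2) * t)).aestronglyMeasurable.mul hum)
  have hv := ae_eq_zero_of_integral_pow_mul_eq_zero hvm ?_ ?_
  · rw [Lp.eq_zero_iff_ae_eq_zero]
    refine (withDensity_absolutelyContinuous _ _).ae_le ?_
    filter_upwards [hv] with t ht
    simpa [(weight_pos hα t).ne'] using ht
  · have h3 := Real.pi_gt_three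
    refine ((hexp 1 (by rw [abs_one]; linarith)).add
      (hexp (-1) (by rw [abs_neg, abs_one]; linarith))).mono' (by fun_prop)
      (Eventually.of_forall fun t => ?_)
    rw [Real.norm_of_nonneg (by positivity), Pi.add_apply, ← add_mul]
    gcongr
    rcases abs_cases t with ⟨h, -⟩ | ⟨h, -⟩ <;> rw [h]
    · simp [(Real.exp_pos _).le]
    · simp [(Real.exp_pos _).le]
  · intro k
    have h := hzero _ (hpow k)
    rw [integral_weightMeasure hα] at h
    rw [← h]
    congr 1; ext t
    have : (starRingEnd ℂ) ((t : ℂ) ^ k * Complex.exp (-(Real.pi / 2) * t)) =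
        (t : ℂ) ^ k * Complex.exp (-(Real.pi / 2) * t) := by
      rw [map_mul, map_pow, Complex.conj_ofReal, ← Complex.exp_conj]
      simp [Complex.conj_ofReal, map_ofNat (starRingEnd ℂ) 2]
    rw [this]
    simp only [Complex.real_smul]
    ring

/-! ### The Jacobi matrix, the deficiency spaces and the conclusion. -/

theorem orthonormal_eigenvec {α : ℝ} (hα : 0 < α) :
    Orthonormal ℂ fun n => ((‖eigenvec hα n‖⁻¹ : ℝ) : ℂ) • eigenvec hα n := by
  refine ⟨fun n => ?_, fun m n hmn => ?_⟩
  · rw [norm_smul, Complex.norm_real, norm_inv, norm_norm,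
      inv_mul_cancel₀ (norm_ne_zero_iff.mpr (eigenvec_ne_zero hα n))]
  · simp only [inner_smul_left, inner_smul_right, inner_eigenvec_of_ne hα hmn, mul_zero]

/-- Bessel's inequality, in the unnormalised form that `eq_zero_of_jacobi_recurrence` takes with ρ n
= ‖e_n‖⁻². -/
theorem sum_inner_eigenvec_le {α : ℝ} (hα : 0 < α) (u : L2w α) (N : ℕ) :
    ∑ n ∈ Finset.range N, (‖eigenvec hα n‖ ^ 2)⁻¹ * ‖inner ℂ (eigenvec hα n) u‖ ^ 2 ≤ ‖u‖ ^ 2 := by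
  refine le_trans (Finset.sum_le_sum fun n _ => le_of_eq ?_)
    ((orthonormal_eigenvec hα).sum_inner_products_le u (s := Finset.range N))
  rw [inner_smul_left, norm_mul, RCLike.norm_conj, Complex.norm_real, norm_inv, norm_norm, mul_pow,
    inv_pow]

theorem diffOp_eq_add (α c : ℝ) (f : ℂ → ℂ) :
    diffOp α c f = diffOp α 0 f + (c : ℂ) • mulVar f := by
  ext s; simp [diffOp]; ring

theorem toL2_mem_graph {α : ℝ} (hα : 0 < α) (φ : ℝ) {f g : H α}
    (h : g.1 = diffOp α (2 * Real.cosh φ) f.1) :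
    (toL2 hα f, toL2 hα g) ∈ (operator α φ).graph := by
  rw [mem_graph_operator hα]
  refine ⟨f, f.2, coeFn_toL2 hα f, ?_⟩
  rw [differenceExpr_eq_diffOp, ← h]
  exact coeFn_toL2 hα g

theorem eigenvec_zero_mem_graph {α : ℝ} (hα : 0 < α) (φ : ℝ) :
    (eigenvec hα 0, (-α : ℂ) • eigenvec hα 0 + (2 * Real.cosh φ / 4 : ℂ) • eigenvec hα 1) ∈
      (operator α φ).graph := by
  simp only [eigenvec, ← map_smul, ← map_add]
  refine toL2_mem_graph hα φ ?_
  rw [diffOp_eq_add]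
  simp only [diffOp_eigenfun, mulVar_eigenfun_zero, Submodule.coe_add, Submodule.coe_smul]
  ext s; simp; ring

theorem eigenvec_succ_mem_graph {α : ℝ} (hα : 0 < α) (φ : ℝ) (n : ℕ) :
    (eigenvec hα (n + 1), (-(α + 2 * (n + 1)) : ℂ) • eigenvec hα (n + 1) +
      (2 * Real.cosh φ / 4 : ℂ) • (eigenvec hα (n + 2) +
        (4 * (n + 1) * (α + n) : ℂ) • eigenvec hα n)) ∈ (operator α φ).graph := by
  simp only [eigenvec, ← map_smul, ← map_add]
  refine toL2_mem_graph hα φ ?_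
  rw [diffOp_eq_add]
  simp only [diffOp_eigenfun, mulVar_eigenfun_succ, Submodule.coe_add, Submodule.coe_smul,
    ladderCoeff]
  ext s; simp; ring

/-- Testing against the eigenvectors turns orthogonality to the range of the operator minus z into
the Jacobi recurrence for the coefficients of u. The parameter is conj z because the inner product
is conjugate-linear in its first argument; the matrix entries are real. -/
theorem operator_deficiency {α : ℝ} (hα : 0 < α) (φ : ℝ) {z : ℂ} (hz : z.im ≠ 0) {u : L2w α}
    (hu : ∀ p ∈ (operator α φ).graph, inner ℂ (p.2 - z • p.1) u = 0) : u = 0 := by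
  refine eq_zero_of_inner_eigenvec hα fun m => ?_
  refine eq_zero_of_jacobi_recurrence (α := α) (c := 2 * Real.cosh φ) hα
    (ζ := (starRingEnd ℂ) z) (by simpa using hz) (u := fun n => inner ℂ (eigenvec hα n) u)
    (ρ := fun n => (‖eigenvec hα n‖ ^ 2)⁻¹) ?_ ?_ ?_ ?_ (sum_inner_eigenvec_le hα u) m
  · intro n
    have := norm_pos_iff.mpr (eigenvec_ne_zero hα n)
    positivity
  · intro n
    have h1 := norm_pos_iff.mpr (eigenvec_ne_zero hα n)
    have h2 := ladderCoeff_pos hα n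
    rw [norm_sq_eigenvec_succ, ← ladderCoeff]
    field_simp
  · have h := hu _ (eigenvec_zero_mem_graph hα φ)
    simp only [inner_sub_left, inner_add_left, inner_smul_left, map_neg, map_div₀, map_mul,
      Complex.conj_ofReal, map_ofNat] at h
    rw [Complex.ofReal_mul, Complex.ofReal_ofNat]
    linear_combination -h
  · intro n
    have h := hu _ (eigenvec_succ_mem_graph hα φ n)
    simp only [inner_sub_left, inner_add_left, inner_smul_left, map_neg, map_div₀, map_mul,
      map_add, map_one, map_natCast, Complex.conj_ofReal, map_ofNat] at h
    rw [Complex.ofReal_mul, Complex.ofReal_ofNat]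
    linear_combination -h

theorem operator_isFormalAdjoint {α : ℝ} (hα : 0 < α) (φ : ℝ) :
    (operator α φ).IsFormalAdjoint (operator α φ) := by
  intro x y
  obtain ⟨f, hf, hf1, hf2⟩ := (mem_graph_operator hα φ _ _).mp ((operator α φ).mem_graph x)
  obtain ⟨g, hg, hg1, hg2⟩ := (mem_graph_operator hα φ _ _).mp ((operator α φ).mem_graph y)
  rw [inner_eq_integral hf2 hg1, inner_eq_integral hf1 hg2]
  simp only [differenceExpr_eq_diffOp]
  exact (integral_diffOp hα _ hg hf).symm

theorem operator_dense_domain {α : ℝ} (hα : 0 < α) (φ : ℝ) :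
    Dense ((operator α φ).domain : Set (L2w α)) := by
  rw [Submodule.dense_iff_topologicalClosure_eq_top, Submodule.topologicalClosure_eq_top_iff,
    Submodule.eq_bot_iff]
  intro u hu
  rw [Submodule.mem_orthogonal] at hu
  refine eq_zero_of_inner_eigenvec hα fun n => hu _ ?_
  cases n with
  | zero => exact LinearPMap.mem_domain_of_mem_graph (eigenvec_zero_mem_graph hα φ)
  | succ n => exact LinearPMap.mem_domain_of_mem_graph (eigenvec_succ_mem_graph hα φ n)

theorem operator_isEssentiallySelfAdjoint {α : ℝ} (hα : 0 < α) (φ : ℝ) :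
    (operator α φ).IsEssentiallySelfAdjoint := by
  refine LinearPMap.isEssentiallySelfAdjoint_of_deficiency (operator_dense_domain hα φ)
    (operator_isFormalAdjoint hα φ) (fun u hu => ?_) (fun u hu => ?_)
  · refine operator_deficiency hα φ (z := Complex.I) (by simp) fun p hp => ?_
    obtain ⟨x, hx1, hx2⟩ := LinearPMap.mem_graph_iff _ |>.mp hp
    rw [← hx1, ← hx2]
    exact hu x
  · refine operator_deficiency hα φ (z := -Complex.I) (by simp) fun p hp => ?_
    obtain ⟨x, hx1, hx2⟩ := LinearPMap.mem_graph_iff _ |>.mp hp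
    rw [← hx1, ← hx2, neg_smul, sub_neg_eq_add]
    exact hu x

end Vilenkin

end

theorem mainTheorem3 (α φ : ℝ) (hα : 0 < α) (hφ : 0 < φ) :
    (∀ f ∈ Vilenkin.H α,
      MemLp (fun t : ℝ => f t) 2 (Vilenkin.weightMeasure α) ∧
      MemLp (fun t : ℝ => Vilenkin.differenceExpr α φ f t) 2 (Vilenkin.weightMeasure α)) ∧
    (Vilenkin.operator α φ).IsEssentiallySelfAdjoint := by
  refine ⟨fun f hf => ⟨Vilenkin.memLp_of_mem_H hα hf, ?_⟩,
    Vilenkin.operator_isEssentiallySelfAdjoint hα φ⟩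
  rw [Vilenkin.differenceExpr_eq_diffOp]
  exact Vilenkin.memLp_diffOp hα _ hf
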